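/- **Notation.** Let $\overline{\mathbb Q}$ be the algebraic closure of $\mathbb Q$ in $\mathbb C$, $\Gamma=\mathrm{Gal}(\overline{\mathbb Q}/\mathbb Q)$, and $\iota$ complex conjugation. Algebraic groups over $\mathbb Q$ are regarded as functors on commutative $\mathbb Q$-algebras $R$. For a number field $K$ let $T^K(R)=(K\otimes_{\mathbb Q}R)^\times$; it has character module $X^*(T^K)=\mathbb Z^{\mathrm{Hom}(K,\overline{\mathbb Q})}$. The Serre group $S^K$ is the quotient $\pi^K:T^K\to S^K$ with $X^*(S^K)=\{f\in X^*(T^K)\mid(\sigma-1)(\iota+1)f=0=(\iota+1)(\sigma-1)f\ \forall\sigma\in\Gamma\}$. For $L\subset K$ let $N_{K/L}:T^K\to T^L$ be the norm, and write $N_{K/L}:S^K\to S^L$ also for the map that it induces. Let $(F,\Phi)$ be a CM type. Its reflex field $F^*\subset\overline{\mathbb Q}$ is generated over $\mathbb Q$ by the elements $\sum_{\phi\in\Phi}\phi(e)$, $e\in F$. The cocharacter $\mu_\Phi$ of $T^F$ is $z$ at the embeddings in $\Phi$ and $1$ at the others, and $\rho_\Phi:S^{F^*}\to T^F$ is the morphism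 attached to $\mu_\Phi$ by the universal property of the Serre group: it is the unique morphism over $\mathbb Q$ with $\rho_\Phi\circ\mu^{F^*}=\mu_\Phi$, where $\mu^{F^*}$ is the cocharacter of $S^{F^*}$ that sends a character $f$ to its coefficient at the inclusion $F^*\subset\overline{\mathbb Q}$. The reflex norm is $N_\Phi:T^{F^*}\to T^F$, $a\mapsto\det_{F\otimes R}(a\mid V\otimes R)$, where $V$ is any $F\otimes_{\mathbb Q}F^*$-module, finite-dimensional over $\mathbb Q$, with $\mathrm{Tr}_{F^*}(e\mid V)=\sum_{\phi\in\Phi}\phi(e)$ for all $e\in F$. Let $\mathcal T^F\subset T^F$ be the subgroup with points $\mathcal T^F(R)=\{x\in T^F(R)\mid xx^\iota\in R^\times\}$. **Setting.** Let $K$ be a number field that contains a CM field, $E$ its maximal CM subfield, and $\tau:K\to\overline{\mathbb Q}$ an embedding, through which we regard $E$ as a subfield of $\overline{\mathbb Q}$. Let $(E_i,\Phi_i)$, $1\le i\le r$, be primitive CM types such that $E_i^*\subset E$ for all $i$ and such that $$S^E\xrightarrow{\ \prod N_{E/E_i^*}\ }\prod_i S^{E_i^*}\xrightarrow{\ \prod\rho_{\Phi_i}\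 }\prod_i T^{E_i}$$ is injective. For every $i$ let $\xi_i$ be a generator of $E_i$ over $\mathbb Q$ with $\xi_i^\iota=-\xi_i$, and let $(V_E,\psi_E)$ be the orthogonal sum of the spaces $E_i$ with the forms $\psi_i(x,y)=\mathrm{Tr}_{E_i/\mathbb Q}(\xi_i x y^\iota)$. Let $$\mathcal T\subset\prod_i\mathcal T^{E_i},\qquad \mathcal T(R)=\Big\{(x_i)\in\prod_i\mathcal T^{E_i}(R)\ \Big|\ \exists\,\nu\in R^\times\ \forall i:\ x_ix_i^\iota=\nu\Big\}$$ and let $\mathfrak i:\mathcal T\to GSp(V_E,\psi_E)$ be the inclusion that lets $(x_i)$ act on $\bigoplus_i E_i$ by componentwise multiplication. The map $S^E\to\prod_i T^{E_i}$ above takes values in $\mathcal T$, and $\varphi:T^K\to GSp(V_E,\psi_E)$ is defined as the composite $$T^K\xrightarrow{\pi^K}S^K\xrightarrow{N_{K/E}}S^E\to\mathcal T\xrightarrow{\ \mathfrak i\ }GSp(V_E,\psi_E).$$ **Lemma.** The reflex norms $N_{\Phi_i}$ take values in $\mathcal T^{E_i}$, the composite $$T^K\xrightarrow{\ \prod N_{K/E_i^*}\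 }\prod_i T^{E_i^*}\xrightarrow{\ \prod N_{\Phi_i}\ }\prod_i\mathcal T^{E_i}$$ takes values in $\mathcal T$, and $\varphi$ is equal to its composite with $\mathfrak i:\mathcal T\to GSp(V_E,\psi_E)$. -/

import Mathlib

open CategoryTheory TensorProduct NumberField

universe u v

namespace CMTorus

noncomputable section

/-! ### The algebraic closure of `ℚ` in `ℂ` and its Galois group -/

/-- The algebraic closure of `ℚ` inside `ℂ`. -/
def Qbar : Type := algebraicClosure ℚ ℂ

instance : Field Qbar := inferInstanceAs (Field (algebraicClosure ℚ ℂ))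

instance : CharZero Qbar := inferInstanceAs (CharZero (algebraicClosure ℚ ℂ))

instance : IsAlgClosure ℚ Qbar := algebraicClosure.isAlgClosure ℚ ℂ

instance : IsAlgClosed Qbar := IsAlgClosure.isAlgClosed ℚ

instance : Algebra.IsAlgebraic ℚ Qbar := IsAlgClosure.isAlgebraic

instance : IsGalois ℚ Qbar := IsAlgClosure.isGalois ℚ Qbar

/-- The absolute Galois group of `ℚ`. -/
abbrev GalQ : Type := Qbar ≃ₐ[ℚ] Qbar

/-- The inclusion of `Qbar` into `ℂ`. -/
def toComplex : Qbar →+* ℂ := algebraMap (algebraicClosure ℚ ℂ) ℂ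

/-- Complex conjugation, as an element of the absolute Galois group of `ℚ`. -/
def conj : GalQ :=
  AlgEquiv.ofRingEquiv (f := (show Qbar ≃+* Qbar from
    (algebraicClosure.algEquivOfAlgEquiv (Complex.conjAe.restrictScalars ℚ)).toRingEquiv))
    (fun q => map_ratCast _ q)

theorem toComplex_conj (x : Qbar) : toComplex (conj x) = (starRingEnd ℂ) (toComplex x) := rfl

/-- The inclusion of a subfield, as a homomorphism of `ℚ`-algebras. -/
def incl {F : Type} [Field F] [CharZero F] (L : IntermediateField ℚ F) : L →ₐ[ℚ] F :=
  (algebraMap L F).toRatAlgHom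

/-- The Galois group acts on the embeddings `K → Qbar` by composition. -/
abbrev gact {K : Type} [Field K] [NumberField K] (σ : GalQ) (ρ : K →ₐ[ℚ] Qbar) :
    K →ₐ[ℚ] Qbar :=
  (σ : Qbar →ₐ[ℚ] Qbar).comp ρ

/-! ### Algebraic groups over `ℚ`, by their functors of points

An algebraic group over `ℚ` is given by its functor of points, a functor from commutative
`ℚ`-algebras to groups, and a homomorphism of algebraic groups is a natural transformation. -/

/-- Group functors on commutative `ℚ`-algebras. -/
abbrev QGroup : Type (u + 1) := CommAlgCat.{u} ℚ ⥤ GrpCat.{u}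

namespace QGroup

/-- A homomorphism of group functors from homomorphisms that are natural on points. -/
def mkHom {G H : QGroup.{u}} (F : ∀ R, G.obj R →* H.obj R)
    (hF : ∀ {R S : CommAlgCat.{u} ℚ} (f : R ⟶ S) (x : G.obj R),
      F S (G.map f x) = H.map f (F R x)) : G ⟶ H where
  app R := GrpCat.ofHom (F R)
  naturality R S f := by
    ext x
    exact hF f x

@[simp] theorem mkHom_app {G H : QGroup.{u}} (F : ∀ R, G.obj R →* H.obj R)
    (hF : ∀ {R S : CommAlgCat.{u} ℚ} (f : R ⟶ S) (x : G.obj R),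
      F S (G.map f x) = H.map f (F R x)) (R : CommAlgCat.{u} ℚ) (x : G.obj R) :
    (mkHom F hF).app R x = F R x := rfl

theorem naturality_apply {G H : QGroup.{u}} (F : G ⟶ H) {R S : CommAlgCat.{u} ℚ} (f : R ⟶ S)
    (x : G.obj R) : F.app S (G.map f x) = H.map f (F.app R x) :=
  ConcreteCategory.congr_hom (F.naturality f) x

theorem hom_ext' {G H : QGroup.{u}} {F F' : G ⟶ H}
    (h : ∀ (R : CommAlgCat.{u} ℚ) (x : G.obj R), F.app R x = F'.app R x) : F = F' := by
  ext R x
  exact h R x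

/-- The product of a family of group functors. -/
def pi {ι : Type} (G : ι → QGroup.{u}) : QGroup.{u} where
  obj R := GrpCat.of (∀ i, (G i).obj R)
  map f := GrpCat.ofHom (MonoidHom.mk'
    (fun x i => (G i).map f (x i)) (fun x y => by
      funext i; exact map_mul ((G i).map f).hom (x i) (y i)))
  map_id R := by
    ext x : 2
    funext i
    exact ConcreteCategory.congr_hom ((G i).map_id R) (x i)
  map_comp f g := by
    ext x : 2
    funext i
    exact ConcreteCategory.congr_hom ((G i).map_comp f g) (x i)

/-- The homomorphism to a product with given components. -/
def piLift {ι : Type} {H : QGroup.{u}} {G : ι → QGroup.{u}} (F : ∀ i, H ⟶ G i) :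
    H ⟶ pi G :=
  mkHom (fun R => MonoidHom.mk' (fun x i => (F i).app R x) (fun x y => by
      funext i; exact map_mul ((F i).app R).hom x y))
    (fun f x => by funext i; exact naturality_apply (F i) f x)

/-- The product of a family of homomorphisms. -/
def piMap {ι : Type} {G H : ι → QGroup.{u}} (F : ∀ i, G i ⟶ H i) : pi G ⟶ pi H :=
  mkHom (fun R => MonoidHom.mk' (fun x i => (F i).app R (x i))
      (fun x y => by funext i; exact map_mul ((F i).app R).hom (x i) (y i)))
    (fun f x => by funext i; exact naturality_apply (F i) f (x i))

/-- A subgroup functor of a group functor. -/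
structure Sub (G : QGroup.{u}) where
  /-- its points -/
  pts : ∀ R : CommAlgCat.{u} ℚ, Subgroup (G.obj R)
  map_mem : ∀ {R S : CommAlgCat.{u} ℚ} (f : R ⟶ S) (x : G.obj R), x ∈ pts R → G.map f x ∈ pts S

namespace Sub

/-- A subgroup functor, as a group functor. -/
def toQGroup {G : QGroup.{u}} (H : Sub G) : QGroup.{u} where
  obj R := GrpCat.of (H.pts R)
  map {R S} f := GrpCat.ofHom (((G.map f).hom.comp (H.pts R).subtype).codRestrict (H.pts S)
    (fun x => H.map_mem f x x.2))
  map_id R := by ext x; simp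
  map_comp f g := by
    ext x
    exact ConcreteCategory.congr_hom (G.map_comp f g) x.1

/-- The inclusion of a subgroup functor. -/
def ι {G : QGroup.{u}} (H : Sub G) : H.toQGroup ⟶ G :=
  mkHom (fun R => (H.pts R).subtype) (fun _ _ => rfl)

/-- The factorization of a homomorphism through a subgroup functor that contains its image. -/
def lift {G G' : QGroup.{u}} (H : Sub G) (F : G' ⟶ G)
    (hF : ∀ (R : CommAlgCat.{u} ℚ) (x : G'.obj R), F.app R x ∈ H.pts R) : G' ⟶ H.toQGroup :=
  mkHom (fun R => (F.app R).hom.codRestrict (H.pts R) (hF R))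
    (fun f x => Subtype.ext (naturality_apply F f x))

theorem lift_ι {G G' : QGroup.{u}} (H : Sub G) (F : G' ⟶ G)
    (hF : ∀ (R : CommAlgCat.{u} ℚ) (x : G'.obj R), F.app R x ∈ H.pts R) :
    H.lift F hF ≫ H.ι = F := rfl

end Sub

end QGroup

/-! ### The torus `T^K` and tori with given character module -/

/-- The homomorphism `(R ⊗ K)ˣ → (S ⊗ L)ˣ` induced by `R → S` and `K → L`. -/
def tmap {R S : Type u} {K L : Type} [CommRing R] [Algebra ℚ R] [CommRing S]
    [Algebra ℚ S] [CommRing K] [Algebra ℚ K] [CommRing L] [Algebra ℚ L]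
    (f : R →ₐ[ℚ] S) (g : K →ₐ[ℚ] L) : (R ⊗[ℚ] K)ˣ →* (S ⊗[ℚ] L)ˣ :=
  Units.map (Algebra.TensorProduct.map f g : R ⊗[ℚ] K →* S ⊗[ℚ] L)

section tmap

variable {R S S' : Type u} {K L M : Type}
  [CommRing R] [Algebra ℚ R] [CommRing S] [Algebra ℚ S] [CommRing S'] [Algebra ℚ S']
  [CommRing K] [Algebra ℚ K] [CommRing L] [Algebra ℚ L] [CommRing M] [Algebra ℚ M]

theorem tmap_id (x : (R ⊗[ℚ] K)ˣ) : tmap (AlgHom.id ℚ R) (AlgHom.id ℚ K) x = x := by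
  ext
  simp [tmap]

theorem tmap_tmap (f : R →ₐ[ℚ] S) (g : K →ₐ[ℚ] L) (f' : S →ₐ[ℚ] S') (g' : L →ₐ[ℚ] M)
    (x : (R ⊗[ℚ] K)ˣ) : tmap f' g' (tmap f g x) = tmap (f'.comp f) (g'.comp g) x := by
  ext
  simp [tmap, Algebra.TensorProduct.map_comp]

end tmap

/-- The torus `T^K = Res_{K/ℚ} 𝔾ₘ`, with points `T^K(R) = (R ⊗ K)ˣ`. -/
def torus (K : Type) [Field K] [NumberField K] : QGroup.{u} where
  obj R := GrpCat.of (R ⊗[ℚ] K)ˣ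
  map f := GrpCat.ofHom (tmap f.hom (AlgHom.id ℚ K))
  map_id R := by ext x : 2; exact tmap_id x
  map_comp f g := by ext x : 2; exact (tmap_tmap f.hom (AlgHom.id ℚ K) g.hom (AlgHom.id ℚ K) x).symm

/-- The action of the Galois group on the second factor of `(R ⊗ Qbar)ˣ`. -/
def galU (R : Type u) [CommRing R] [Algebra ℚ R] (σ : GalQ) :
    (R ⊗[ℚ] Qbar)ˣ →* (R ⊗[ℚ] Qbar)ˣ :=
  tmap (AlgHom.id ℚ R) (σ : Qbar →ₐ[ℚ] Qbar)

/-- The points of the `ℚ`-torus with character module `M`: the homomorphisms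
`M → (R ⊗ Qbar)ˣ` that commute with the Galois group. -/
def diagPts (M : Type) [AddCommGroup M] [DistribMulAction GalQ M] (R : Type u) [CommRing R]
    [Algebra ℚ R] : Subgroup (Multiplicative M →* (R ⊗[ℚ] Qbar)ˣ) where
  carrier := {s | ∀ (σ : GalQ) (m : M),
    s (Multiplicative.ofAdd (σ • m)) = galU R σ (s (Multiplicative.ofAdd m))}
  mul_mem' {s t} hs ht σ m := by simp [hs σ m, ht σ m]
  one_mem' σ m := by simp
  inv_mem' {s} hs σ m := by simp [hs σ m]

/-- The algebraic group of multiplicative type over `ℚ` whose character module is the Galois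
module `M`; its points are `Hom_{Gal}(M, (R ⊗ Qbar)ˣ)`. -/
def diag (M : Type) [AddCommGroup M] [DistribMulAction GalQ M] : QGroup.{u} where
  obj R := GrpCat.of (diagPts M R)
  map {R S} f := GrpCat.ofHom (MonoidHom.mk'
    (fun s => (⟨(tmap f.hom (AlgHom.id ℚ Qbar)).comp s.1, fun σ m => by
      change tmap _ _ (s.1 _) = tmap _ _ (tmap _ _ (s.1 _))
      rw [s.2 σ m, galU, tmap_tmap, tmap_tmap]
      rfl⟩ : diagPts M S))
    (fun s t => by
      apply Subtype.ext
      exact MonoidHom.ext fun m => map_mul (tmap f.hom (AlgHom.id ℚ Qbar)) (s.1 m) (t.1 m)))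
  map_id R := by
    ext s : 2
    apply Subtype.ext
    exact MonoidHom.ext fun m => tmap_id (s.1 m)
  map_comp f g := by
    ext s : 2
    apply Subtype.ext
    exact MonoidHom.ext fun m =>
      (tmap_tmap f.hom (AlgHom.id ℚ Qbar) g.hom (AlgHom.id ℚ Qbar) (s.1 m)).symm

/-- The homomorphism of groups of multiplicative type that is dual to a homomorphism of character
modules. -/
def diagMap {M N : Type} [AddCommGroup M] [DistribMulAction GalQ M] [AddCommGroup N]
    [DistribMulAction GalQ N] (g : N →+[GalQ] M) : diag.{u} M ⟶ diag.{u} N :=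
  QGroup.mkHom (fun R => MonoidHom.mk'
    (fun s => (⟨s.1.comp (AddMonoidHom.toMultiplicative (g : N →+ M)), fun σ n => by
      change s.1 (Multiplicative.ofAdd (g (σ • n))) = galU R σ (s.1 (Multiplicative.ofAdd (g n)))
      rw [map_smul, s.2]⟩ : diagPts N R))
    (fun s t => rfl)) (fun f s => rfl)

/-! ### The character lattice of `T^K` -/

/-- The character lattice `X^*(T^K) = ℤ^{Hom(K, Qbar)}`. -/
abbrev CharLattice (K : Type) [Field K] [NumberField K] : Type := (K →ₐ[ℚ] Qbar) → ℤ

namespace CharLattice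

variable (K : Type) [Field K] [NumberField K]

/-- The Galois action `(σ f)(ρ) = f (σ⁻¹ ∘ ρ)`. -/
instance : DistribMulAction GalQ (CharLattice K) where
  smul σ f := fun ρ => f (gact σ⁻¹ ρ)
  one_smul _ := rfl
  mul_smul σ τ f := by
    funext ρ
    change f _ = f _
    rw [mul_inv_rev]
    rfl
  smul_zero _ := rfl
  smul_add _ _ _ := rfl

variable {K}

theorem smul_apply (σ : GalQ) (f : CharLattice K) (ρ : K →ₐ[ℚ] Qbar) :
    (σ • f) ρ = f (gact σ⁻¹ ρ) := rfl

theorem add_apply (f g : CharLattice K) (ρ : K →ₐ[ℚ] Qbar) : (f + g) ρ = f ρ + g ρ := rfl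

/-- The character `[ρ]` of `T^K` given by an embedding `ρ`. -/
def single (ρ : K →ₐ[ℚ] Qbar) : CharLattice K :=
  open Classical in (Pi.single ρ 1 : (K →ₐ[ℚ] Qbar) → ℤ)

theorem smul_single (σ : GalQ) (ρ : K →ₐ[ℚ] Qbar) : σ • single ρ = single (gact σ ρ) := by
  classical
  funext ψ
  change (Pi.single ρ 1 : (K →ₐ[ℚ] Qbar) → ℤ) (gact σ⁻¹ ψ) =
    (Pi.single (gact σ ρ) 1 : (K →ₐ[ℚ] Qbar) → ℤ) ψ
  rw [Pi.single_apply, Pi.single_apply]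
  refine if_congr ⟨fun h => ?_, fun h => ?_⟩ rfl rfl
  · rw [← h]
    ext x
    exact (σ.apply_symm_apply (ψ x)).symm
  · rw [h]
    ext x
    exact σ.symm_apply_apply (ρ x)

theorem eq_sum (f : CharLattice K) : f = ∑ ρ, f ρ • single ρ := by
  classical
  funext ψ
  change f ψ = (∑ ρ, f ρ • (Pi.single ρ 1 : (K →ₐ[ℚ] Qbar) → ℤ)) ψ
  rw [Finset.sum_apply, Finset.sum_eq_single ψ]
  · simp
  · intro ρ _ h
    simp [h.symm]
  · simp

end CharLattice

/-! ### Galois descent for the points of `T^K` -/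

section Descent

theorem exists_algEquiv_comp {F L M : Type*} [Field F] [Field L] [Field M] [Algebra F L]
    [Algebra F M] [Normal F M] (φ ψ : L →ₐ[F] M) :
    ∃ σ : M ≃ₐ[F] M, (σ : M →ₐ[F] M).comp φ = ψ := by
  let e : φ.fieldRange ≃ₐ[F] ψ.fieldRange :=
    (AlgEquiv.ofInjectiveField φ).symm.trans (AlgEquiv.ofInjectiveField ψ)
  refine ⟨e.liftNormal M, ?_⟩
  ext x
  have h := e.liftNormal_commutes M (AlgEquiv.ofInjectiveField φ x)
  have h2 : e (AlgEquiv.ofInjectiveField φ x) = AlgEquiv.ofInjectiveField ψ x := by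
    exact congrArg (AlgEquiv.ofInjectiveField ψ) ((AlgEquiv.ofInjectiveField φ).symm_apply_apply x)
  rw [h2] at h
  exact h

theorem mem_range_of_fixed {F L M : Type*} [Field F] [Field L] [Field M] [Algebra F L]
    [Algebra F M] [IsGalois F M] (φ : L →ₐ[F] M) (x : M)
    (hx : ∀ σ : M ≃ₐ[F] M, (σ : M →ₐ[F] M).comp φ = φ → σ x = x) : ∃ y, φ y = x := by
  let _ := φ.toRingHom.toAlgebra
  have : IsScalarTower F L M := IsScalarTower.of_algebraMap_eq fun a => (φ.commutes a).symm
  have : IsGalois L M := IsGalois.tower_top_of_isGalois F L M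
  have := (InfiniteGalois.mem_bot_iff_fixed (k := L) x).mpr (fun σ => by
    refine hx (σ.restrictScalars F) ?_
    ext y
    exact σ.commutes y)
  exact this

variable {R : Type u} [CommRing R] [Algebra ℚ R] {K : Type} [Field K] [NumberField K]

theorem exists_gact (φ ψ : K →ₐ[ℚ] Qbar) : ∃ σ : GalQ, gact σ φ = ψ :=
  exists_algEquiv_comp φ ψ

theorem tmap_id_injective (φ : K →ₐ[ℚ] Qbar) :
    Function.Injective (tmap (AlgHom.id ℚ R) φ) := by
  refine Units.map_injective ?_
  exact Module.Flat.lTensor_preserves_injective_linearMap (M := R) φ.toLinearMap φ.injective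

theorem equivFinsupp_map {ι : Type*} [DecidableEq ι] (b : Module.Basis ι ℚ R) {A B : Type*} [CommRing A]
    [Algebra ℚ A] [CommRing B] [Algebra ℚ B] (g : A →ₐ[ℚ] B) (x : R ⊗[ℚ] A) (i : ι) :
    TensorProduct.equivFinsuppOfBasisLeft b (Algebra.TensorProduct.map (AlgHom.id ℚ R) g x) i =
      g (TensorProduct.equivFinsuppOfBasisLeft b x i) := by
  induction x with
  | zero => simp
  | add x y hx hy => simp [hx, hy]
  | tmul r l => simp

theorem exists_descent (φ : K →ₐ[ℚ] Qbar) (u : R ⊗[ℚ] Qbar)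
    (hu : ∀ σ : GalQ, gact σ φ = φ →
      Algebra.TensorProduct.map (AlgHom.id ℚ R) (σ : Qbar →ₐ[ℚ] Qbar) u = u) :
    ∃ x : R ⊗[ℚ] K, Algebra.TensorProduct.map (AlgHom.id ℚ R) φ x = u := by
  classical
  let b := Module.Free.chooseBasis ℚ R
  have h : ∀ i, ∃ y : K, φ y = TensorProduct.equivFinsuppOfBasisLeft b u i := fun i =>
    mem_range_of_fixed φ _ fun σ hσ => by
      have := equivFinsupp_map b (σ : Qbar →ₐ[ℚ] Qbar) u i
      rw [hu σ hσ] at this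
      exact this.symm
  choose y hy using h
  let x : R ⊗[ℚ] K := (TensorProduct.equivFinsuppOfBasisLeft b).symm
    (Finsupp.onFinset (TensorProduct.equivFinsuppOfBasisLeft b u).support y (fun i hi => by
      rw [Finsupp.mem_support_iff, ← hy i]
      exact fun h => hi (φ.injective (h.trans (map_zero φ).symm))))
  refine ⟨x, (TensorProduct.equivFinsuppOfBasisLeft b).injective ?_⟩
  ext i
  rw [equivFinsupp_map, ← hy i]
  simp only [x, LinearEquiv.apply_symm_apply, Finsupp.onFinset_apply]

theorem exists_descent_units (φ : K →ₐ[ℚ] Qbar) (u : (R ⊗[ℚ] Qbar)ˣ)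
    (hu : ∀ σ : GalQ, gact σ φ = φ → galU R σ u = u) :
    ∃ x : (R ⊗[ℚ] K)ˣ, tmap (AlgHom.id ℚ R) φ x = u := by
  obtain ⟨x, hx⟩ := exists_descent φ (u : R ⊗[ℚ] Qbar) fun σ hσ =>
    congrArg Units.val (hu σ hσ)
  obtain ⟨y, hy⟩ := exists_descent φ ((u⁻¹ : (R ⊗[ℚ] Qbar)ˣ) : R ⊗[ℚ] Qbar) fun σ hσ => by
    have h : galU R σ u⁻¹ = u⁻¹ := by rw [map_inv, hu σ hσ]
    exact congrArg Units.val h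
  have hinj : Function.Injective (Algebra.TensorProduct.map (AlgHom.id ℚ R) φ) :=
    Module.Flat.lTensor_preserves_injective_linearMap (M := R) φ.toLinearMap φ.injective
  have hxy : x * y = 1 := hinj (by rw [map_mul, hx, hy, map_one, Units.mul_inv])
  exact ⟨⟨x, y, hxy, by rw [mul_comm, hxy]⟩, Units.ext hx⟩

end Descent
/-! ### The torus `T^K` in terms of its characters -/

section TorusChar

variable (K : Type) [Field K] [NumberField K]

/-- The evaluation of the characters of `T^K` at a point `a` of `T^K(R) = (R ⊗ K)ˣ`, which sends
`∑ a_ρ [ρ]` to `∏ (1 ⊗ ρ)(a) ^ a_ρ`. -/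
def evalChars (R : Type u) [CommRing R] [Algebra ℚ R] :
    (R ⊗[ℚ] K)ˣ →* diagPts (CharLattice K) R :=
  MonoidHom.mk'
    (fun a => ⟨MonoidHom.mk'
      (fun f => ∏ ρ : K →ₐ[ℚ] Qbar, tmap (AlgHom.id ℚ R) ρ a ^ (Multiplicative.toAdd f ρ))
      (fun f g => by
        rw [← Finset.prod_mul_distrib]
        exact Finset.prod_congr rfl fun ρ _ => zpow_add _ _ _),
      fun σ f => by
        change ∏ ρ : K →ₐ[ℚ] Qbar, tmap (AlgHom.id ℚ R) ρ a ^ (f (gact σ⁻¹ ρ)) =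
          galU R σ (∏ ρ : K →ₐ[ℚ] Qbar, tmap (AlgHom.id ℚ R) ρ a ^ (f ρ))
        rw [map_prod]
        refine Fintype.prod_bijective (gact σ⁻¹) ?_ _ _ fun ρ => ?_
        · refine Function.bijective_iff_has_inverse.mpr ⟨gact σ, fun ρ => ?_, fun ρ => ?_⟩
          · exact AlgHom.ext fun x => σ.apply_symm_apply (ρ x)
          · exact AlgHom.ext fun x => σ.symm_apply_apply (ρ x)
        · rw [map_zpow, galU, tmap_tmap]
          congr 3
          exact AlgHom.ext fun x => (σ.apply_symm_apply (ρ x)).symm⟩)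
    (fun a b => by
      apply Subtype.ext
      refine MonoidHom.ext fun f => ?_
      change ∏ ρ : K →ₐ[ℚ] Qbar, tmap (AlgHom.id ℚ R) ρ (a * b) ^ (Multiplicative.toAdd f ρ) =
        (∏ ρ : K →ₐ[ℚ] Qbar, tmap (AlgHom.id ℚ R) ρ a ^ (Multiplicative.toAdd f ρ)) *
        (∏ ρ : K →ₐ[ℚ] Qbar, tmap (AlgHom.id ℚ R) ρ b ^ (Multiplicative.toAdd f ρ))
      rw [← Finset.prod_mul_distrib]
      exact Finset.prod_congr rfl fun ρ _ => by rw [map_mul, mul_zpow])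

/-- The evaluation of characters, as a homomorphism from `T^K` to the group of multiplicative type
with character module `X^*(T^K)`. -/
def torusToDiag : torus.{u} K ⟶ diag.{u} (CharLattice K) :=
  QGroup.mkHom (fun R => evalChars K R)
    (fun {R S} h (a : (R ⊗[ℚ] K)ˣ) => by
      apply Subtype.ext
      refine MonoidHom.ext fun f => ?_
      change ∏ ρ : K →ₐ[ℚ] Qbar, tmap (AlgHom.id ℚ S) ρ (tmap h.hom (AlgHom.id ℚ K) a) ^
          (Multiplicative.toAdd f ρ) =
        tmap h.hom (AlgHom.id ℚ Qbar)
          (∏ ρ : K →ₐ[ℚ] Qbar, tmap (AlgHom.id ℚ R) ρ a ^ (Multiplicative.toAdd f ρ))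
      rw [map_prod]
      refine Finset.prod_congr rfl fun ρ _ => ?_
      rw [map_zpow, tmap_tmap, tmap_tmap]
      rfl)

variable {K}

theorem torusToDiag_apply (R : CommAlgCat.{u} ℚ) (a : (R ⊗[ℚ] K)ˣ) (f : CharLattice K) :
    ((torusToDiag K).app R a : diagPts (CharLattice K) R).1 (Multiplicative.ofAdd f) =
      ∏ ρ : K →ₐ[ℚ] Qbar, tmap (AlgHom.id ℚ R) ρ a ^ (f ρ) := rfl

theorem torusToDiag_apply_single (R : CommAlgCat.{u} ℚ) (a : (R ⊗[ℚ] K)ˣ) (ρ : K →ₐ[ℚ] Qbar) :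
    ((torusToDiag K).app R a : diagPts (CharLattice K) R).1
      (Multiplicative.ofAdd (CharLattice.single ρ)) = tmap (AlgHom.id ℚ R) ρ a := by
  classical
  rw [torusToDiag_apply, Finset.prod_eq_single ρ]
  · simp [CharLattice.single]
  · intro ψ _ h
    simp [CharLattice.single, h]
  · simp

theorem diagPts_ext {R : Type u} [CommRing R] [Algebra ℚ R] {s t : diagPts (CharLattice K) R}
    (h : ∀ ρ, s.1 (Multiplicative.ofAdd (CharLattice.single ρ)) =
      t.1 (Multiplicative.ofAdd (CharLattice.single ρ))) : s = t := by
  apply Subtype.ext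
  refine MonoidHom.ext fun f => ?_
  have key : ∀ r : diagPts (CharLattice K) R, r.1 f =
      ∏ ρ, r.1 (Multiplicative.ofAdd (CharLattice.single ρ)) ^ (Multiplicative.toAdd f ρ) := by
    intro r
    conv_lhs => rw [show f = Multiplicative.ofAdd (∑ ρ, (Multiplicative.toAdd f) ρ •
      CharLattice.single ρ) from congrArg Multiplicative.ofAdd (CharLattice.eq_sum _)]
    rw [ofAdd_sum, map_prod]
    exact Finset.prod_congr rfl fun ρ _ => by rw [ofAdd_zsmul, map_zpow]
  rw [key s, key t]
  exact Finset.prod_congr rfl fun ρ _ => by rw [h]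

theorem torusToDiag_bijective (R : CommAlgCat.{u} ℚ) :
    Function.Bijective ((torusToDiag K).app R) := by
  have φ : K →ₐ[ℚ] Qbar := IsAlgClosed.lift
  constructor
  · intro a b h
    apply tmap_id_injective φ
    have h' := congrArg (fun s : diagPts (CharLattice K) R =>
      s.1 (Multiplicative.ofAdd (CharLattice.single φ))) h
    exact (torusToDiag_apply_single R a φ).symm.trans (h'.trans (torusToDiag_apply_single R b φ))
  · intro s
    change diagPts (CharLattice K) R at s
    obtain ⟨a, ha⟩ := exists_descent_units φ
      (s.1 (Multiplicative.ofAdd (CharLattice.single φ))) (fun σ hσ => by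
        rw [← s.2 σ, CharLattice.smul_single, hσ])
    refine ⟨a, diagPts_ext fun ρ => ?_⟩
    refine (torusToDiag_apply_single R a ρ).trans ?_
    obtain ⟨σ, rfl⟩ := exists_gact φ ρ
    rw [← CharLattice.smul_single, s.2 σ, ← ha, galU, tmap_tmap]
    rfl

/-- `T^K` is the torus with character module `X^*(T^K)`. -/
instance : IsIso (torusToDiag.{u} K) := by
  have : ∀ R, IsIso ((torusToDiag.{u} K).app R) := fun R =>
    (ConcreteCategory.isIso_iff_bijective _).mpr (torusToDiag_bijective R)
  exact NatIso.isIso_of_isIso_app _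

end TorusChar

/-! ### The Serre group -/

section Serre

variable (K : Type) [Field K] [NumberField K]

/-- The characters `f` of `T^K` that satisfy the Serre condition
`(σ - 1)(ι + 1) f = 0 = (ι + 1)(σ - 1) f` for all `σ`. -/
def serreChars : AddSubgroup (CharLattice K) where
  carrier := {f | ∀ σ : GalQ, σ • (conj • f + f) - (conj • f + f) = 0 ∧
    conj • (σ • f - f) + (σ • f - f) = 0}
  zero_mem' σ := by simp
  add_mem' {f g} hf hg σ := by
    constructor
    · have := congrArg₂ (· + ·) (hf σ).1 (hg σ).1
      simp only [smul_add, add_zero] at this ⊢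
      rw [← this]; abel
    · have := congrArg₂ (· + ·) (hf σ).2 (hg σ).2
      simp only [smul_sub, smul_add, add_zero] at this ⊢
      rw [← this]; abel
  neg_mem' {f} hf σ := by
    constructor
    · have := congrArg (- ·) (hf σ).1
      simp only [smul_add, smul_neg, neg_zero] at this ⊢
      rw [← this]; abel
    · have := congrArg (- ·) (hf σ).2
      simp only [smul_sub, smul_neg, neg_zero] at this ⊢
      rw [← this]; abel

variable {K}

theorem smul_mem_serreChars (τ : GalQ) {f : CharLattice K} (hf : f ∈ serreChars K) :
    τ • f ∈ serreChars K := by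
  have h1 : ∀ σ : GalQ, conj • σ • f + σ • f = conj • f + f := by
    intro σ
    have := (hf σ).2
    rw [smul_sub] at this
    rw [← sub_eq_zero, ← this]; abel
  intro σ
  constructor
  · rw [h1 τ]
    exact (hf σ).1
  · rw [smul_sub, smul_smul σ τ]
    have h2 := h1 (σ * τ)
    have h3 := h1 τ
    rw [← sub_eq_zero.mpr (h2.trans h3.symm)]; abel

instance : DistribMulAction GalQ (serreChars K) where
  smul σ f := ⟨σ • f.1, smul_mem_serreChars σ f.2⟩
  one_smul _ := Subtype.ext (one_smul _ _)
  mul_smul σ τ f := Subtype.ext (mul_smul σ τ f.1)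
  smul_zero σ := Subtype.ext (smul_zero σ)
  smul_add σ f g := Subtype.ext (smul_add σ f.1 g.1)

variable (K)

/-- The Serre group `S^K`: the torus whose character module consists of the characters of `T^K`
that satisfy the Serre condition. -/
def serreGroup : QGroup.{u} := diag.{u} (serreChars K)

/-- The quotient map `π^K : T^K → S^K`, dual to the inclusion `X^*(S^K) ⊆ X^*(T^K)`. -/
def serreProj : torus.{u} K ⟶ serreGroup.{u} K :=
  torusToDiag K ≫ diagMap
    { toFun := Subtype.val
      map_smul' := fun _ _ => rfl
      map_zero' := rfl
      map_add' := fun _ _ => rfl }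

end Serre
/-! ### Norm maps -/

section Norm

variable {K L : Type} [Field K] [NumberField K] [Field L] [NumberField L]

/-- The restriction `f ↦ f_K`, `f_K(ρ) = f(ρ|_L)`, of characters along an embedding `L → K`. -/
def CharLattice.pull (j : L →ₐ[ℚ] K) (f : CharLattice L) : CharLattice K := fun ρ => f (ρ.comp j)

theorem CharLattice.pull_mem (j : L →ₐ[ℚ] K) {f : CharLattice L} (hf : f ∈ serreChars L) :
    CharLattice.pull j f ∈ serreChars K := fun σ =>
  ⟨congrArg (CharLattice.pull j) (hf σ).1, congrArg (CharLattice.pull j) (hf σ).2⟩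

/-- The homomorphism `N_{K/L} : S^K → S^L` of Serre groups that is induced by the norm; on
characters it is `f ↦ f_K`. -/
def serreNorm (j : L →ₐ[ℚ] K) : serreGroup.{u} K ⟶ serreGroup.{u} L :=
  diagMap
    { toFun := fun f => ⟨CharLattice.pull j f.1, CharLattice.pull_mem j f.2⟩
      map_smul' := fun _ _ => rfl
      map_zero' := rfl
      map_add' := fun _ _ => rfl }

theorem det_semilinear {A A' M M' ι : Type*} [CommRing A] [CommRing A'] [AddCommGroup M]
    [Module A M] [AddCommGroup M'] [Module A' M'] [Fintype ι] [DecidableEq ι] (g : A →+* A')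
    (h : M →ₛₗ[g] M') (b : Module.Basis ι A M) (b' : Module.Basis ι A' M')
    (hb : ∀ i, h (b i) = b' i) (f : Module.End A M) (f' : Module.End A' M')
    (hf : ∀ x, f' (h x) = h (f x)) : LinearMap.det f' = g (LinearMap.det f) := by
  have hrepr : ∀ x i, b'.repr (h x) i = g (b.repr x i) := by
    intro x i
    have hx : h x = ∑ k, g (b.repr x k) • b' k := by
      conv_lhs => rw [← b.sum_repr x]
      rw [map_sum]
      exact Finset.sum_congr rfl fun k _ => by rw [map_smulₛₗ, hb]
    rw [hx, b'.repr_sum_self]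
  rw [← LinearMap.det_toMatrix b, ← LinearMap.det_toMatrix b', RingHom.map_det]
  congr 1
  ext i j
  simp [LinearMap.toMatrix_apply, ← hb, hf, hrepr]

/-- A basis of `V` over `L` is a basis of `R ⊗ V` over `R ⊗ L`. -/
def tensorBasis (R : Type u) [CommRing R] [Algebra ℚ R] {V ι : Type*} [AddCommGroup V]
    [Module ℚ V] [Module L V] [Finite ι] [Module (R ⊗[ℚ] L) (R ⊗[ℚ] V)]
    (hs : ∀ (r s : R) (l : L) (x : V), (r ⊗ₜ[ℚ] l) • (s ⊗ₜ[ℚ] x) = (r * s) ⊗ₜ[ℚ] (l • x))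
    (c : Module.Basis ι L V) : Module.Basis ι (R ⊗[ℚ] L) (R ⊗[ℚ] V) :=
  have := Fintype.ofFinite ι
  open Classical in
  let e : R ⊗[ℚ] V ≃ₗ[ℚ] (ι → R ⊗[ℚ] L) :=
    (TensorProduct.congr (LinearEquiv.refl ℚ R) (c.equivFun.restrictScalars ℚ)).trans
      (TensorProduct.piRight ℚ ℚ R fun _ => L)
  have he : ∀ s x i, e (s ⊗ₜ x) i = s ⊗ₜ[ℚ] c.repr x i := fun s x i => by simp [e]
  Module.Basis.ofEquivFun
    { e with
      map_smul' := fun a y => by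
        change e (a • y) = a • e y
        induction y with
        | zero => simp
        | add y z hy hz => rw [smul_add, map_add, hy, hz, map_add, smul_add]
        | tmul s x =>
          induction a with
          | zero => simp
          | add a b ha hb => rw [add_smul, map_add, ha, hb, add_smul]
          | tmul r l =>
            funext i
            rw [hs, he, Pi.smul_apply, he]
            simp }

theorem tensorBasis_apply (R : Type u) [CommRing R] [Algebra ℚ R] {V ι : Type*} [AddCommGroup V]
    [Module ℚ V] [Module L V] [Finite ι] [Module (R ⊗[ℚ] L) (R ⊗[ℚ] V)]
    (hs : ∀ (r s : R) (l : L) (x : V), (r ⊗ₜ[ℚ] l) • (s ⊗ₜ[ℚ] x) = (r * s) ⊗ₜ[ℚ] (l • x))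
    (c : Module.Basis ι L V) (i : ι) : tensorBasis R hs c i = 1 ⊗ₜ c i := by
  classical
  apply (tensorBasis R hs c).repr.injective
  rw [Module.Basis.repr_self]
  ext k
  simp [tensorBasis, Finsupp.single_apply]
  split_ifs
  · rfl
  · rw [TensorProduct.tmul_zero]

/-- The `R ⊗ L`-algebra structure of `R ⊗ K` that is given by an embedding `L → K`. -/
abbrev tensorAlgebra (R : Type u) [CommRing R] [Algebra ℚ R] (j : L →ₐ[ℚ] K) :
    Algebra (R ⊗[ℚ] L) (R ⊗[ℚ] K) :=
  (Algebra.TensorProduct.map (AlgHom.id ℚ R) j).toRingHom.toAlgebra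

/-- The norm of the `R ⊗ L`-algebra `R ⊗ K`. -/
def tensorNorm (R : Type u) [CommRing R] [Algebra ℚ R] (j : L →ₐ[ℚ] K) :
    R ⊗[ℚ] K →* R ⊗[ℚ] L :=
  letI := tensorAlgebra R j
  Algebra.norm (R ⊗[ℚ] L)

theorem tensorNorm_map {R S : Type u} [CommRing R] [Algebra ℚ R] [CommRing S] [Algebra ℚ S]
    (h : R →ₐ[ℚ] S) (j : L →ₐ[ℚ] K) (a : R ⊗[ℚ] K) :
    tensorNorm S j (Algebra.TensorProduct.map h (AlgHom.id ℚ K) a) =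
      Algebra.TensorProduct.map h (AlgHom.id ℚ L) (tensorNorm R j a) := by
  let iR := tensorAlgebra R j
  let iS := tensorAlgebra S j
  let _ := j.toRingHom.toAlgebra
  have : IsScalarTower ℚ L K := IsScalarTower.of_algebraMap_eq fun a => (j.commutes a).symm
  have : FiniteDimensional L K := FiniteDimensional.right ℚ L K
  let c := Module.finBasis L K
  have hR : ∀ (r s : R) (l : L) (x : K),
      (r ⊗ₜ[ℚ] l) • (s ⊗ₜ[ℚ] x) = (r * s) ⊗ₜ[ℚ] (l • x) := fun r s l x => by
    rw [Algebra.smul_def, Algebra.smul_def]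
    exact Algebra.TensorProduct.tmul_mul_tmul _ _ _ _
  have hS : ∀ (r s : S) (l : L) (x : K),
      (r ⊗ₜ[ℚ] l) • (s ⊗ₜ[ℚ] x) = (r * s) ⊗ₜ[ℚ] (l • x) := fun r s l x => by
    rw [Algebra.smul_def, Algebra.smul_def]
    exact Algebra.TensorProduct.tmul_mul_tmul _ _ _ _
  let g : R ⊗[ℚ] L →+* S ⊗[ℚ] L := (Algebra.TensorProduct.map h (AlgHom.id ℚ L)).toRingHom
  let H : R ⊗[ℚ] K →ₛₗ[g] S ⊗[ℚ] K :=
    { toFun := Algebra.TensorProduct.map h (AlgHom.id ℚ K)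
      map_add' := map_add _
      map_smul' := fun r x => by
        rw [Algebra.smul_def, Algebra.smul_def, map_mul]
        congr 1
        change Algebra.TensorProduct.map h (AlgHom.id ℚ K)
            (Algebra.TensorProduct.map (AlgHom.id ℚ R) j r) =
          Algebra.TensorProduct.map (AlgHom.id ℚ S) j
            (Algebra.TensorProduct.map h (AlgHom.id ℚ L) r)
        rw [← AlgHom.comp_apply, ← AlgHom.comp_apply, ← Algebra.TensorProduct.map_comp,
          ← Algebra.TensorProduct.map_comp]
        rfl }
  refine det_semilinear g H (tensorBasis R hR c) (tensorBasis S hS c) (fun i => ?_)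
    (Algebra.lmul _ _ a) (Algebra.lmul _ _ _) (fun x => ?_)
  · rw [tensorBasis_apply, tensorBasis_apply]
    simp [H]
  · exact (map_mul (Algebra.TensorProduct.map h (AlgHom.id ℚ K)) a x).symm

/-- The norm map `N_{K/L} : T^K → T^L` along an embedding `L → K`; on points it is the norm of the
`R ⊗ L`-algebra `R ⊗ K`. -/
def torusNorm (j : L →ₐ[ℚ] K) : torus.{u} K ⟶ torus.{u} L :=
  QGroup.mkHom
    (fun R => (Units.map (tensorNorm R j) : (R ⊗[ℚ] K)ˣ →* (R ⊗[ℚ] L)ˣ))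
    (fun {R _} h (a : (R ⊗[ℚ] K)ˣ) => Units.ext (tensorNorm_map h.hom j a))

/-! ### Determinants of commuting actions -/

/-- The action of `R ⊗ L` on `R ⊗ V`, for an `L`-vector space `V`. -/
def tensorAct (R : Type u) [CommRing R] [Algebra ℚ R] (L : Type) [Field L] [NumberField L]
    (V : Type v) [AddCommGroup V] [Module ℚ V] [Module L V] :
    R ⊗[ℚ] L →ₐ[R] Module.End R (R ⊗[ℚ] V) :=
  (LinearMap.tensorProductEnd ℚ R V).comp
    (Algebra.TensorProduct.map (AlgHom.id R R) (Algebra.lsmul ℚ ℚ V))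

theorem tensorAct_tmul (R : Type u) [CommRing R] [Algebra ℚ R] (L : Type) [Field L]
    [NumberField L] (V : Type v) [AddCommGroup V] [Module ℚ V] [Module L V] (r s : R) (l : L)
    (x : V) : tensorAct R L V (r ⊗ₜ l) (s ⊗ₜ x) = (r * s) ⊗ₜ (l • x) := by
  rfl

/-- The `R ⊗ L`-module structure of `R ⊗ V`, for an `L`-vector space `V`. -/
abbrev tensorModule (R : Type u) [CommRing R] [Algebra ℚ R] (L : Type) [Field L]
    [NumberField L] (V : Type v) [AddCommGroup V] [Module ℚ V] [Module L V] :
    Module (R ⊗[ℚ] L) (R ⊗[ℚ] V) :=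
  Module.compHom (R ⊗[ℚ] V) (tensorAct R L V).toRingHom

theorem tensorAct_comm (R : Type u) [CommRing R] [Algebra ℚ R] (V : Type v) [AddCommGroup V]
    [Module ℚ V] [Module L V] [Module K V] [SMulCommClass L K V] (a : R ⊗[ℚ] K) (b : R ⊗[ℚ] L)
    (x : R ⊗[ℚ] V) :
    tensorAct R K V a (tensorAct R L V b x) = tensorAct R L V b (tensorAct R K V a x) := by
  induction x with
  | zero => simp
  | add x y hx hy => simp only [map_add, hx, hy]
  | tmul s x =>
    induction a with
    | zero => simp
    | add a a' ha ha' => simp only [map_add, LinearMap.add_apply, ha, ha']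
    | tmul r k =>
      induction b with
      | zero => simp
      | add b b' hb hb' => simp only [map_add, LinearMap.add_apply, hb, hb']
      | tmul t l => simp only [tensorAct_tmul, smul_comm l k x, mul_left_comm]

/-- For a vector space `V` over `L` with a commuting action of `K`, the map
`a ↦ det_{R ⊗ L}(a | R ⊗ V)` from `R ⊗ K` to `R ⊗ L`. -/
def tensorDet (R : Type u) [CommRing R] [Algebra ℚ R] (L K : Type) [Field L] [NumberField L]
    [Field K] [NumberField K] (V : Type v) [AddCommGroup V] [Module ℚ V] [Module L V] [Module K V]
    [SMulCommClass L K V] : R ⊗[ℚ] K →* R ⊗[ℚ] L :=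
  letI := tensorModule R L V
  LinearMap.det.comp
    { toFun := fun a =>
        ({ toFun := tensorAct R K V a
           map_add' := map_add _
           map_smul' := fun b x => tensorAct_comm R V a b x } :
          Module.End (R ⊗[ℚ] L) (R ⊗[ℚ] V))
      map_one' := LinearMap.ext fun x => by
        change tensorAct R K V 1 x = x
        rw [map_one]; rfl
      map_mul' := fun a b => LinearMap.ext fun x => by
        change tensorAct R K V (a * b) x = tensorAct R K V a (tensorAct R K V b x)
        rw [map_mul]; rfl }

theorem tensorAct_map {R S : Type u} [CommRing R] [Algebra ℚ R] [CommRing S] [Algebra ℚ S]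
    (h : R →ₐ[ℚ] S) (V : Type v) [AddCommGroup V] [Module ℚ V] [Module L V] (a : R ⊗[ℚ] L)
    (x : R ⊗[ℚ] V) :
    tensorAct S L V (Algebra.TensorProduct.map h (AlgHom.id ℚ L) a)
      (h.toLinearMap.rTensor V x) = h.toLinearMap.rTensor V (tensorAct R L V a x) := by
  induction x with
  | zero => simp
  | add x y hx hy => simp only [map_add, hx, hy]
  | tmul s x =>
    induction a with
    | zero => simp
    | add a a' ha ha' => simp only [map_add, LinearMap.add_apply, ha, ha']
    | tmul r k => simp [tensorAct_tmul]

theorem tensorDet_map {R S : Type u} [CommRing R] [Algebra ℚ R] [CommRing S] [Algebra ℚ S]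
    (h : R →ₐ[ℚ] S) (V : Type v) [AddCommGroup V] [Module ℚ V] [Module L V] [Module K V]
    [SMulCommClass L K V] [FiniteDimensional L V] (a : R ⊗[ℚ] K) :
    tensorDet S L K V (Algebra.TensorProduct.map h (AlgHom.id ℚ K) a) =
      Algebra.TensorProduct.map h (AlgHom.id ℚ L) (tensorDet R L K V a) := by
  let iR := tensorModule R L V
  let iS := tensorModule S L V
  let c := Module.finBasis L V
  let g : R ⊗[ℚ] L →+* S ⊗[ℚ] L := (Algebra.TensorProduct.map h (AlgHom.id ℚ L)).toRingHom
  let H : R ⊗[ℚ] V →ₛₗ[g] S ⊗[ℚ] V :=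
    { toFun := h.toLinearMap.rTensor V
      map_add' := map_add _
      map_smul' := fun r x => (tensorAct_map h V r x).symm }
  refine det_semilinear g H (tensorBasis R (tensorAct_tmul R L V) c)
    (tensorBasis S (tensorAct_tmul S L V) c) (fun i => ?_) _ _ (fun x => ?_)
  · rw [tensorBasis_apply, tensorBasis_apply]
    simp [H]
  · exact tensorAct_map h V a x

/-- For a finite-dimensional vector space `V` over `L` with a commuting action of `K`, the
homomorphism `T^K → T^L`, `a ↦ det_{R ⊗ L}(a | R ⊗ V)`. -/
def torusDet (L K : Type) [Field L] [NumberField L] [Field K] [NumberField K] (V : Type v)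
    [AddCommGroup V] [Module ℚ V] [Module L V] [Module K V] [SMulCommClass L K V]
    [FiniteDimensional L V] : torus.{u} K ⟶ torus.{u} L :=
  QGroup.mkHom
    (fun R => (Units.map (tensorDet R L K V) : (R ⊗[ℚ] K)ˣ →* (R ⊗[ℚ] L)ˣ))
    (fun {R _} h (a : (R ⊗[ℚ] K)ˣ) => Units.ext (tensorDet_map h.hom V (a : R ⊗[ℚ] K)))

end Norm
/-! ### The universal property of the Serre group -/

section Universal

variable {M : Type} [AddCommGroup M] [DistribMulAction GalQ M]

/-- The Galois action `(σ μ)(m) = μ (σ⁻¹ m)` on the cocharacters `Hom(M, ℤ)` of a torus with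
character module `M`. -/
def cocharAct (σ : GalQ) (μ : M →+ ℤ) : M →+ ℤ :=
  μ.comp (DistribSMul.toAddMonoidHom M σ⁻¹)

variable {K : Type} [Field K] [NumberField K]

/-- A cocharacter is defined over `K` (embedded by `τ`) and satisfies the Serre condition
`(ι + 1)(σ - 1) μ = 0 = (σ - 1)(ι + 1) μ` for all `σ`. -/
structure IsSerreCochar (τ : K →ₐ[ℚ] Qbar) (μ : M →+ ℤ) : Prop where
  defined_over : ∀ σ : GalQ, gact σ τ = τ → cocharAct σ μ = μ
  serre_left : ∀ σ : GalQ,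
    cocharAct conj (cocharAct σ μ - μ) + (cocharAct σ μ - μ) = 0
  serre_right : ∀ σ : GalQ,
    cocharAct σ (cocharAct conj μ + μ) - (cocharAct conj μ + μ) = 0

theorem conj_inv : (conj⁻¹ : GalQ) = conj := by
  rw [inv_eq_iff_mul_eq_one]
  ext x
  apply toComplex.injective
  change toComplex (conj (conj x)) = toComplex x
  rw [toComplex_conj, toComplex_conj, Complex.conj_conj]

variable {τ : K →ₐ[ℚ] Qbar} {μ : M →+ ℤ}

/-- The character `ψ ↦ (σ μ)(m)`, where `σ` is any automorphism with `σ ∘ τ = ψ`. -/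
def univChar (τ : K →ₐ[ℚ] Qbar) (μ : M →+ ℤ) (m : M) : CharLattice K :=
  fun ψ => cocharAct (exists_gact τ ψ).choose μ m

theorem univChar_gact (h : IsSerreCochar τ μ) (m : M) (σ : GalQ) :
    univChar τ μ m (gact σ τ) = μ (σ⁻¹ • m) := by
  have hσ := (exists_gact τ (gact σ τ)).choose_spec
  set ρ := (exists_gact τ (gact σ τ)).choose with hρ
  have h1 : gact (σ⁻¹ * ρ) τ = τ := by
    ext x
    change σ.symm (gact ρ τ x) = τ x
    rw [hσ]
    exact σ.symm_apply_apply _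
  have h2 := DFunLike.congr_fun (h.defined_over _ h1) (σ⁻¹ • m)
  change μ (ρ⁻¹ • m) = _
  rw [← h2]
  change _ = μ ((σ⁻¹ * ρ)⁻¹ • σ⁻¹ • m)
  rw [smul_smul, mul_inv_rev, inv_inv, mul_assoc, mul_inv_cancel, mul_one]

theorem univChar_smul (h : IsSerreCochar τ μ) (σ : GalQ) (m : M) :
    univChar τ μ (σ • m) = σ • univChar τ μ m := by
  funext ψ
  obtain ⟨γ, rfl⟩ := exists_gact τ ψ
  rw [univChar_gact h, CharLattice.smul_apply,
    show gact σ⁻¹ (gact γ τ) = gact (σ⁻¹ * γ) τ from rfl, univChar_gact h, smul_smul,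
    mul_inv_rev, inv_inv]

theorem univChar_mem (h : IsSerreCochar τ μ) (m : M) : univChar τ μ m ∈ serreChars K := by
  have hadd : ∀ a b : M, univChar τ μ (a + b) = univChar τ μ a + univChar τ μ b := fun a b => by
    funext ψ; exact map_add _ a b
  have hsub : ∀ a b : M, univChar τ μ (a - b) = univChar τ μ a - univChar τ μ b := fun a b => by
    funext ψ; exact map_sub _ a b
  have hr : ∀ (σ : GalQ) (a : M), μ (conj • σ⁻¹ • a + σ⁻¹ • a) = μ (conj • a + a) := by
    intro σ a
    have := DFunLike.congr_fun (h.serre_right σ) a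
    change (μ (conj⁻¹ • σ⁻¹ • a) + μ (σ⁻¹ • a)) - (μ (conj⁻¹ • a) + μ a) = 0 at this
    rw [conj_inv] at this
    rw [map_add, map_add]
    omega
  have hl : ∀ (σ : GalQ) (a : M), μ (σ⁻¹ • (conj • a + a)) = μ (conj • a + a) := by
    intro σ a
    have := DFunLike.congr_fun (h.serre_left σ) a
    change (μ (σ⁻¹ • conj⁻¹ • a) - μ (conj⁻¹ • a)) + (μ (σ⁻¹ • a) - μ a) = 0 at this
    rw [conj_inv] at this
    rw [smul_add, map_add, map_add]
    omega
  intro σ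
  simp only [← univChar_smul h, ← hadd, ← hsub]
  constructor
  · funext ψ
    obtain ⟨γ, rfl⟩ := exists_gact τ ψ
    rw [univChar_gact h, smul_sub, map_sub, smul_smul]
    have h1 := hl (σ⁻¹ * γ) m
    have h2 := hl γ m
    rw [mul_inv_rev, inv_inv] at h1
    rw [h1, h2]
    exact sub_self _
  · funext ψ
    obtain ⟨γ, rfl⟩ := exists_gact τ ψ
    rw [univChar_gact h, hl, map_add, smul_sub, map_sub, map_sub]
    have h1 := hr σ⁻¹ m
    rw [inv_inv, map_add, map_add] at h1
    change _ = (0 : ℤ)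
    omega

/-- The dual of the morphism `ρ_μ` in the universal property of the Serre group: the Galois
equivariant map `M → X^*(S^K)` that corresponds to a cocharacter `μ`. -/
def serreUniv (τ : K →ₐ[ℚ] Qbar) (μ : M →+ ℤ) (h : IsSerreCochar τ μ) :
    M →+[GalQ] serreChars K where
  toFun m := ⟨univChar τ μ m, univChar_mem h m⟩
  map_smul' σ m := Subtype.ext (univChar_smul h σ m)
  map_zero' := Subtype.ext (by funext ψ; exact map_zero _)
  map_add' a b := Subtype.ext (by funext ψ; exact map_add _ a b)

/-- The defining property `ρ_μ ∘ μ^K = μ`, where the canonical cocharacter `μ^K` of `S^K` sends a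
character `f` to `f(τ)`. -/
theorem serreUniv_apply (h : IsSerreCochar τ μ) (m : M) :
    (serreUniv τ μ h m).1 τ = μ m := by
  have := univChar_gact h m 1
  rw [inv_one, one_smul] at this
  exact this

theorem serreUniv_unique (h : IsSerreCochar τ μ) (g : M →+[GalQ] serreChars K)
    (hg : ∀ m, (g m).1 τ = μ m) : g = serreUniv τ μ h := by
  refine DistribMulActionHom.ext fun m => Subtype.ext ?_
  funext ψ
  obtain ⟨γ, rfl⟩ := exists_gact τ ψ
  have h1 : (γ⁻¹ • g m).1 τ = μ (γ⁻¹ • m) := by rw [← map_smul, hg]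
  have h2 : (γ⁻¹ • g m).1 τ = (g m).1 (gact (γ⁻¹)⁻¹ τ) := rfl
  rw [inv_inv] at h2
  exact (h2.symm.trans h1).trans (univChar_gact h m γ).symm

/-- The morphism `ρ_μ : S^K → T` to the torus `T` with character module `M` that is attached by
the universal property of the Serre group to a cocharacter `μ` of `T`. -/
def serreRho (τ : K →ₐ[ℚ] Qbar) (μ : M →+ ℤ) (h : IsSerreCochar τ μ) :
    serreGroup.{u} K ⟶ diag.{u} M :=
  diagMap (serreUniv τ μ h)

end Universal

/-! ### CM types, reflex fields and reflex norms -/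

section CM

variable (E : Type) [Field E] [NumberField E]

/-- A CM type on the CM field `E`. -/
structure CMType where
  /-- the underlying set of embeddings -/
  emb : Finset (E →ₐ[ℚ] Qbar)
  union_conj : (emb : Set (E →ₐ[ℚ] Qbar)) ∪ gact conj '' emb = Set.univ
  inter_conj : (emb : Set (E →ₐ[ℚ] Qbar)) ∩ gact conj '' emb = ∅

/-- The complex conjugation of a CM field. -/
def cmConj [IsCMField E] : E →ₐ[ℚ] E := (IsCMField.complexConj E : E →+* E).toRatAlgHom

variable {E}

theorem gact_conj [IsCMField E] (φ : E →ₐ[ℚ] Qbar) : gact conj φ = φ.comp (cmConj E) := by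
  ext x
  apply toComplex.injective
  change toComplex (conj (φ x)) = toComplex (φ (IsCMField.complexConj E x))
  rw [toComplex_conj]
  exact (IsCMField.complexEmbedding_complexConj E (toComplex.comp (φ : E →+* Qbar)) x).symm

namespace CMType

/-- A CM type is primitive if it is not induced from a proper CM subfield. -/
def IsPrimitive (Φ : CMType E) : Prop :=
  ∀ (F : IntermediateField ℚ E) [IsCMField F] (Φ₀ : CMType F),
    (∀ φ : E →ₐ[ℚ] Qbar, φ ∈ Φ.emb ↔ φ.comp (incl F) ∈ Φ₀.emb) → F = ⊤

/-- The reflex field of a CM type: the field generated by the elements `∑_{φ ∈ Φ} φ(e)`. -/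
def reflexField (Φ : CMType E) : IntermediateField ℚ Qbar :=
  IntermediateField.adjoin ℚ (Set.range fun e : E => ∑ φ ∈ Φ.emb, φ e)

instance (Φ : CMType E) : NumberField Φ.reflexField where
  to_finiteDimensional := by
    have h : Φ.reflexField ≤ IntermediateField.normalClosure ℚ E Qbar := by
      refine IntermediateField.adjoin_le_iff.mpr ?_
      rintro _ ⟨e, rfl⟩
      refine sum_mem fun φ _ => ?_
      exact φ.fieldRange_le_normalClosure ⟨e, rfl⟩
    have : FiniteDimensional ℚ (IntermediateField.normalClosure ℚ E Qbar) :=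
      normalClosure.is_finiteDimensional ℚ E Qbar
    exact Submodule.finiteDimensional_of_le (S₁ := Φ.reflexField.toSubalgebra.toSubmodule)
      (S₂ := (IntermediateField.normalClosure ℚ E Qbar).toSubalgebra.toSubmodule) h

theorem gact_injective (σ : GalQ) : Function.Injective (gact (K := E) σ) := fun _ _ h =>
  AlgHom.ext fun x => σ.injective (DFunLike.congr_fun h x)

theorem mem_emb_of_fixed (Φ : CMType E) (σ : GalQ)
    (hσ : gact σ (incl Φ.reflexField) = incl Φ.reflexField) (φ : E →ₐ[ℚ] Qbar) :
    gact σ φ ∈ Φ.emb ↔ φ ∈ Φ.emb := by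
  classical
  have hsum : ∀ e : E, ∑ φ ∈ Φ.emb.image (gact σ), φ e = ∑ φ ∈ Φ.emb, φ e := by
    intro e
    rw [Finset.sum_image fun _ _ _ _ h => gact_injective σ h]
    have h1 : σ (∑ φ ∈ Φ.emb, φ e) = ∑ φ ∈ Φ.emb, φ e :=
      DFunLike.congr_fun hσ
        (⟨_, IntermediateField.subset_adjoin _ _ ⟨e, rfl⟩⟩ : Φ.reflexField)
    rw [map_sum] at h1
    exact h1
  have hlin := linearIndependent_toLinearMap ℚ E Qbar
  rw [Fintype.linearIndependent_iff] at hlin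
  have h2 := hlin (fun ψ => (if ψ ∈ Φ.emb.image (gact σ) then 1 else 0) -
    (if ψ ∈ Φ.emb then 1 else 0)) (by
      ext e
      simp only [sub_smul, ite_smul, one_smul, zero_smul, Finset.sum_sub_distrib,
        Finset.sum_ite_mem, Finset.univ_inter]
      rw [LinearMap.sub_apply, LinearMap.sum_apply, LinearMap.sum_apply]
      exact sub_eq_zero.mpr (hsum e))
  have h3 : ∀ ψ, ψ ∈ Φ.emb.image (gact σ) ↔ ψ ∈ Φ.emb := by
    intro ψ
    have := h2 ψ
    by_cases ha : ψ ∈ Φ.emb.image (gact σ) <;> by_cases hb : ψ ∈ Φ.emb <;> simp_all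
  rw [← h3, Finset.mem_image]
  exact ⟨fun ⟨ψ, h, h'⟩ => gact_injective σ h' ▸ h, fun h => ⟨φ, h, rfl⟩⟩

/-- The cocharacter `μ_Φ` of `T^E`, with components `z` at `φ ∈ Φ` and `1` at `φ ∉ Φ`; its pairing
with a character `∑ a_φ [φ]` is `∑_{φ ∈ Φ} a_φ`. -/
def mu (Φ : CMType E) : CharLattice E →+ ℤ where
  toFun m := ∑ φ ∈ Φ.emb, m φ
  map_zero' := Finset.sum_const_zero
  map_add' _ _ := Finset.sum_add_distrib

theorem mu_conj_add (Φ : CMType E) (m : CharLattice E) :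
    Φ.mu (conj • m) + Φ.mu m = ∑ φ, m φ := by
  classical
  have h1 : Φ.mu (conj • m) = ∑ φ ∈ Φ.emb.image (gact conj), m φ := by
    rw [Finset.sum_image fun _ _ _ _ h => gact_injective conj h]
    refine Finset.sum_congr rfl fun φ _ => ?_
    rw [CharLattice.smul_apply, conj_inv]
  have h2 : Disjoint (Φ.emb.image (gact conj)) Φ.emb := by
    rw [← Finset.disjoint_coe, Finset.coe_image, disjoint_comm, Set.disjoint_iff_inter_eq_empty]
    exact Φ.inter_conj
  have h3 : Φ.emb.image (gact conj) ∪ Φ.emb = Finset.univ := by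
    rw [← Finset.coe_inj, Finset.coe_union, Finset.coe_image, Set.union_comm, Finset.coe_univ]
    exact Φ.union_conj
  rw [h1, ← h3, Finset.sum_union h2]
  rfl

theorem sum_smul (σ : GalQ) (m : CharLattice E) : ∑ φ, (σ • m) φ = ∑ φ, m φ := by
  refine Fintype.sum_bijective (gact σ⁻¹) ?_ _ _ fun φ => rfl
  exact Finite.injective_iff_bijective.mp (gact_injective σ⁻¹)

theorem smul_conj_comm [IsCMField E] (σ : GalQ) (m : CharLattice E) : σ • conj • m = conj • σ • m := by
  funext φ
  simp only [CharLattice.smul_apply, conj_inv]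
  rw [gact_conj, gact_conj]
  rfl

theorem isSerreCochar [IsCMField E] (Φ : CMType E) : IsSerreCochar (incl Φ.reflexField) Φ.mu where
  defined_over σ hσ := by
    ext m
    change ∑ φ ∈ Φ.emb, m (gact (σ⁻¹)⁻¹ φ) = ∑ φ ∈ Φ.emb, m φ
    rw [inv_inv]
    refine Finset.sum_bijective (gact σ)
      (Finite.injective_iff_bijective.mp (gact_injective σ)) (fun φ => ?_) fun φ _ => rfl
    exact (Φ.mem_emb_of_fixed σ hσ φ).symm
  serre_left σ := by
    ext m
    change (Φ.mu (σ⁻¹ • conj⁻¹ • m) - Φ.mu (conj⁻¹ • m)) + (Φ.mu (σ⁻¹ • m) - Φ.mu m) = 0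
    rw [conj_inv, smul_conj_comm]
    have h1 := Φ.mu_conj_add m
    have h2 := Φ.mu_conj_add (σ⁻¹ • m)
    rw [sum_smul] at h2
    omega
  serre_right σ := by
    ext m
    change (Φ.mu (conj⁻¹ • σ⁻¹ • m) + Φ.mu (σ⁻¹ • m)) - (Φ.mu (conj⁻¹ • m) + Φ.mu m) = 0
    rw [conj_inv, Φ.mu_conj_add m, Φ.mu_conj_add (σ⁻¹ • m), sum_smul, sub_self]

/-- The morphism `ρ_Φ : S^{E^*} → T^E` that is attached by the universal property of the Serre
group to the cocharacter `μ_Φ`. -/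
def rho [IsCMField E] (Φ : CMType E) : serreGroup.{u} Φ.reflexField ⟶ torus.{u} E :=
  serreRho (incl Φ.reflexField) Φ.mu Φ.isSerreCochar ≫ inv (torusToDiag E)

/-- An `E ⊗ E^*`-module `V` with `Tr_{E^*}(e | V) = ∑_{φ ∈ Φ} φ(e)` for all `e ∈ E`. -/
structure ReflexModule (Φ : CMType E) where
  /-- the underlying space -/
  carrier : Type v
  [addCommGroup : AddCommGroup carrier]
  [moduleRat : Module ℚ carrier]
  [moduleField : Module E carrier]
  [moduleReflex : Module Φ.reflexField carrier]
  [smulComm : SMulCommClass E Φ.reflexField carrier]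
  [finiteDim : FiniteDimensional ℚ carrier]
  trace_eq : ∀ e : E,
    ((LinearMap.trace Φ.reflexField carrier
      (DistribSMul.toLinearMap Φ.reflexField carrier e) : Φ.reflexField) : Qbar) =
        ∑ φ ∈ Φ.emb, φ e

attribute [instance] ReflexModule.addCommGroup ReflexModule.moduleRat ReflexModule.moduleField
  ReflexModule.moduleReflex ReflexModule.smulComm ReflexModule.finiteDim

instance (Φ : CMType E) (V : ReflexModule.{v} Φ) : FiniteDimensional E V.carrier :=
  Module.Finite.of_restrictScalars_finite ℚ E V.carrier

/-- The reflex norm `N_Φ : T^{E^*} → T^E`, `a ↦ det_{E ⊗ R}(a | V ⊗ R)`. -/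
def reflexNorm (Φ : CMType E) (V : ReflexModule.{v} Φ) : torus.{u} Φ.reflexField ⟶ torus.{u} E :=
  torusDet E Φ.reflexField V.carrier

end CMType

end CM
/-! ### The tori `𝒯^E` -/

section CalT

/-- `ν ∈ Rˣ` is the multiplier of `x ∈ (R ⊗ E)ˣ`, that is, `x x^ι = ν`. -/
def IsMultiplier {R : Type u} [CommRing R] [Algebra ℚ R] {E : Type} [Field E] [NumberField E]
    [IsCMField E] (x : (R ⊗[ℚ] E)ˣ) (ν : Rˣ) : Prop :=
  x * tmap (AlgHom.id ℚ R) (cmConj E) x =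
    Units.map (Algebra.TensorProduct.includeLeft : R →ₐ[ℚ] R ⊗[ℚ] E) ν

namespace IsMultiplier

variable {R S : Type u} [CommRing R] [Algebra ℚ R] [CommRing S] [Algebra ℚ S]
  {E : Type} [Field E] [NumberField E] [IsCMField E] {x y : (R ⊗[ℚ] E)ˣ} {ν ν' : Rˣ}

theorem one : IsMultiplier (1 : (R ⊗[ℚ] E)ˣ) 1 := by simp [IsMultiplier]

theorem mul (hx : IsMultiplier x ν) (hy : IsMultiplier y ν') : IsMultiplier (x * y) (ν * ν') := by
  rw [IsMultiplier] at *
  rw [map_mul, map_mul, ← hx, ← hy, mul_mul_mul_comm]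

theorem inv (hx : IsMultiplier x ν) : IsMultiplier x⁻¹ ν⁻¹ := by
  rw [IsMultiplier] at *
  rw [map_inv, map_inv, ← hx, mul_inv]

theorem map (h : R →ₐ[ℚ] S) (hx : IsMultiplier x ν) :
    IsMultiplier (tmap h (AlgHom.id ℚ E) x) (Units.map h ν) := by
  rw [IsMultiplier] at *
  have := congrArg (tmap h (AlgHom.id ℚ E)) hx
  rw [map_mul, tmap_tmap] at this
  rw [tmap_tmap]
  refine this.trans ?_
  ext
  simp [tmap]

end IsMultiplier

/-- The subtorus `𝒯^E` of `T^E`, with points `{x ∈ (R ⊗ E)ˣ | x x^ι ∈ Rˣ}`. -/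
def calT (E : Type) [Field E] [NumberField E] [IsCMField E] : QGroup.Sub (torus.{u} E) where
  pts R :=
    { carrier := {x | ∃ ν : Rˣ, IsMultiplier (x : (R ⊗[ℚ] E)ˣ) ν}
      mul_mem' := fun ⟨ν, h⟩ ⟨ν', h'⟩ => ⟨ν * ν', h.mul h'⟩
      one_mem' := ⟨1, IsMultiplier.one⟩
      inv_mem' := fun ⟨ν, h⟩ => ⟨ν⁻¹, h.inv⟩ }
  map_mem {R S} f _ := fun ⟨ν, h⟩ => ⟨Units.map (f.hom : R →* S) ν, h.map f.hom⟩

/-- The subtorus of `∏ 𝒯^{E_i}` of the families `(x_i)` with a common multiplier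
`x_i x_i^ι = ν`. -/
def calTEq {r : ℕ} (E : Fin r → Type) [∀ i, Field (E i)] [∀ i, NumberField (E i)]
    [∀ i, IsCMField (E i)] : QGroup.Sub (QGroup.pi fun i => (calT.{u} (E i)).toQGroup) where
  pts R :=
    { carrier := {x | ∃ ν : Rˣ, ∀ i, IsMultiplier (((calT (E i)).ι.app R (x i) :) : (R ⊗[ℚ] E i)ˣ) ν}
      mul_mem' := fun ⟨ν, h⟩ ⟨ν', h'⟩ => ⟨ν * ν', fun i => (h i).mul (h' i)⟩
      one_mem' := ⟨1, fun _ => IsMultiplier.one⟩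
      inv_mem' := fun ⟨ν, h⟩ => ⟨ν⁻¹, fun i => (h i).inv⟩ }
  map_mem {R S} f _ := fun ⟨ν, h⟩ => ⟨Units.map (f.hom : R →* S) ν, fun i => (h i).map f.hom⟩

end CalT

/-! ### General linear and general symplectic groups -/

section GSp

/-- The base change of an `R`-linear endomorphism of `R ⊗ V` along `R → S`. -/
def endMap {R S : Type u} [CommRing R] [Algebra ℚ R] [CommRing S] [Algebra ℚ S] (h : R →ₐ[ℚ] S)
    {V : Type} [AddCommGroup V] [Module ℚ V] (f : Module.End R (R ⊗[ℚ] V)) :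
    Module.End S (S ⊗[ℚ] V) :=
  LinearMap.liftBaseChange S
    (h.toLinearMap.rTensor V ∘ₗ f.restrictScalars ℚ ∘ₗ TensorProduct.mk ℚ R V 1)

section

variable {R S S' : Type u} [CommRing R] [Algebra ℚ R] [CommRing S] [Algebra ℚ S]
  [CommRing S'] [Algebra ℚ S'] {V : Type} [AddCommGroup V] [Module ℚ V]

theorem rTensor_smul (h : R →ₐ[ℚ] S) (r : R) (x : R ⊗[ℚ] V) :
    h.toLinearMap.rTensor V (r • x) = h r • h.toLinearMap.rTensor V x := by
  induction x with
  | zero => simp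
  | add x y hx hy => simp only [smul_add, map_add, hx, hy]
  | tmul s v => simp [TensorProduct.smul_tmul']

theorem endMap_rTensor (h : R →ₐ[ℚ] S) (f : Module.End R (R ⊗[ℚ] V)) (x : R ⊗[ℚ] V) :
    endMap h f (h.toLinearMap.rTensor V x) = h.toLinearMap.rTensor V (f x) := by
  induction x with
  | zero => simp
  | add x y hx hy => simp only [map_add, hx, hy]
  | tmul s v =>
    have : s ⊗ₜ[ℚ] v = s • ((1 : R) ⊗ₜ[ℚ] v) := by simp [TensorProduct.smul_tmul']
    rw [this, map_smul f, rTensor_smul, rTensor_smul, map_smul (endMap h f)]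
    simp [endMap]

theorem end_ext {f g : Module.End S (S ⊗[ℚ] V)} (h : ∀ v, f (1 ⊗ₜ v) = g (1 ⊗ₜ v)) : f = g := by
  ext v
  exact h v

theorem endMap_one (h : R →ₐ[ℚ] S) : endMap h (1 : Module.End R (R ⊗[ℚ] V)) = 1 :=
  end_ext fun v => by simp [endMap]

theorem endMap_mul (h : R →ₐ[ℚ] S) (f g : Module.End R (R ⊗[ℚ] V)) :
    endMap h (f * g) = endMap h f * endMap h g :=
  end_ext fun v => by
    have h1 : (1 : S) ⊗ₜ[ℚ] v = h.toLinearMap.rTensor V (1 ⊗ₜ v) := by simp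
    rw [h1, Module.End.mul_apply, endMap_rTensor, endMap_rTensor, endMap_rTensor,
      Module.End.mul_apply]

theorem endMap_id (f : Module.End R (R ⊗[ℚ] V)) : endMap (AlgHom.id ℚ R) f = f :=
  end_ext fun v => by
    have := endMap_rTensor (AlgHom.id ℚ R) f (1 ⊗ₜ v)
    simpa using this

theorem endMap_comp (h : R →ₐ[ℚ] S) (h' : S →ₐ[ℚ] S') (f : Module.End R (R ⊗[ℚ] V)) :
    endMap (h'.comp h) f = endMap h' (endMap h f) :=
  end_ext fun v => by
    have h1 : (1 : S') ⊗ₜ[ℚ] v = (h'.comp h).toLinearMap.rTensor V (1 ⊗ₜ v) := by simp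
    have h2 : (h'.comp h).toLinearMap.rTensor V =
      h'.toLinearMap.rTensor V ∘ₗ h.toLinearMap.rTensor V := by
      rw [← LinearMap.rTensor_comp]; rfl
    rw [h1, endMap_rTensor, h2, LinearMap.comp_apply, LinearMap.comp_apply, endMap_rTensor,
      endMap_rTensor]

/-- Base change of endomorphisms, as a homomorphism of monoids. -/
def endMapHom (h : R →ₐ[ℚ] S) (V : Type) [AddCommGroup V] [Module ℚ V] :
    Module.End R (R ⊗[ℚ] V) →* Module.End S (S ⊗[ℚ] V) where
  toFun := endMap h
  map_one' := endMap_one h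
  map_mul' := endMap_mul h

end

/-- The general linear group `GL(V)`, with points the `R`-linear automorphisms of `R ⊗ V`. -/
def linGroup (V : Type) [AddCommGroup V] [Module ℚ V] : QGroup.{u} where
  obj R := GrpCat.of (Module.End R (R ⊗[ℚ] V))ˣ
  map f := GrpCat.ofHom (Units.map (endMapHom f.hom V))
  map_id R := by
    ext x : 2
    exact Units.ext (endMap_id x.1)
  map_comp f g := by
    ext x : 2
    exact Units.ext (endMap_comp f.hom g.hom x.1)

theorem baseChange_rTensor {R S : Type u} [CommRing R] [Algebra ℚ R] [CommRing S] [Algebra ℚ S]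
    (h : R →ₐ[ℚ] S) {V : Type} [AddCommGroup V] [Module ℚ V] (B : LinearMap.BilinForm ℚ V)
    (x y : R ⊗[ℚ] V) :
    B.baseChange S (h.toLinearMap.rTensor V x) (h.toLinearMap.rTensor V y) =
      h (B.baseChange R x y) := by
  induction x with
  | zero => simp
  | add x x' hx hx' => simp only [map_add, LinearMap.add_apply, hx, hx']
  | tmul s v =>
    induction y with
    | zero => simp
    | add y y' hy hy' => simp only [map_add, hy, hy']
    | tmul t w => simp [LinearMap.BilinForm.baseChange_tmul]

/-- The general symplectic group of a bilinear form `B` on `V`, with points the automorphisms `f`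
of `R ⊗ V` such that `B_R(f x, f y) = ν B_R(x, y)` for all `x, y`, for some `ν ∈ Rˣ`. -/
def GSp {V : Type} [AddCommGroup V] [Module ℚ V] (B : LinearMap.BilinForm ℚ V) :
    QGroup.Sub (linGroup.{u} V) where
  pts R :=
    { carrier := {f | ∃ ν : Rˣ, ∀ x y : R ⊗[ℚ] V,
        B.baseChange R ((f : (Module.End R (R ⊗[ℚ] V))ˣ).1 x)
          ((f : (Module.End R (R ⊗[ℚ] V))ˣ).1 y) = ν * B.baseChange R x y}
      mul_mem' := fun ⟨ν, h⟩ ⟨ν', h'⟩ => ⟨ν * ν', fun x y => by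
        refine (h _ _).trans ?_
        rw [h' x y, Units.val_mul, mul_assoc]⟩
      one_mem' := ⟨1, fun x y => by
        rw [Units.val_one, one_mul]; rfl⟩
      inv_mem' := fun {f} ⟨ν, h⟩ => ⟨ν⁻¹, fun x y => by
        have hf : ∀ z, (f : (Module.End R (R ⊗[ℚ] V))ˣ).1
            ((f⁻¹ : (Module.End R (R ⊗[ℚ] V))ˣ).1 z) = z := fun z =>
          LinearMap.congr_fun (Units.mul_inv (f : (Module.End R (R ⊗[ℚ] V))ˣ)) z
        have := h ((f⁻¹ : (Module.End R (R ⊗[ℚ] V))ˣ).1 x)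
          ((f⁻¹ : (Module.End R (R ⊗[ℚ] V))ˣ).1 y)
        rw [hf, hf] at this
        rw [this, Units.inv_mul_cancel_left]
        rfl⟩ }
  map_mem {R S} f x := fun ⟨ν, h⟩ => ⟨Units.map (f.hom : R →* S) ν, by
    intro v w
    change B.baseChange S (endMap f.hom x.1 v) (endMap f.hom x.1 w) = f.hom ν * B.baseChange S v w
    induction v with
    | zero => simp
    | add v v' hv hv' => simp only [map_add, LinearMap.add_apply, hv, hv', mul_add]
    | tmul s v =>
      induction w with
      | zero => simp
      | add w w' hw hw' => simp only [map_add, hw, hw', mul_add]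
      | tmul t w =>
        have hv : s ⊗ₜ[ℚ] v = s • f.hom.toLinearMap.rTensor V (1 ⊗ₜ v) := by
          simp [TensorProduct.smul_tmul']
        have hw : t ⊗ₜ[ℚ] w = t • f.hom.toLinearMap.rTensor V (1 ⊗ₜ w) := by
          simp [TensorProduct.smul_tmul']
        rw [hv, hw]
        simp only [map_smul, LinearMap.smul_apply, endMap_rTensor, baseChange_rTensor]
        have hx := congrArg f.hom (h (1 ⊗ₜ v) (1 ⊗ₜ w))
        rw [map_mul] at hx
        refine (congrArg (fun z => t • s • z) hx).trans ?_
        simp only [smul_eq_mul]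
        ring⟩

end GSp
/-! ### The symplectic space `(V_E, ψ_E)` and the embedding of tori -/

section Symplectic

/-- The form `ψ(x, y) = Tr_{E/ℚ}(ξ x y^ι)` on a CM field `E`. -/
def cmForm {E : Type} [Field E] [NumberField E] [IsCMField E] (ξ : E) : LinearMap.BilinForm ℚ E :=
  LinearMap.mk₂ ℚ (fun x y => Algebra.trace ℚ E (ξ * x * cmConj E y))
    (fun x x' y => by rw [mul_add, add_mul, map_add])
    (fun c x y => by rw [mul_smul_comm, smul_mul_assoc, map_smul])
    (fun x y y' => by rw [map_add, mul_add, map_add])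
    (fun c x y => by
      have h : cmConj E (c • y) = c • cmConj E y := (cmConj E).toLinearMap.map_smul c y
      rw [h, mul_smul_comm, map_smul])

variable {r : ℕ} {E : Fin r → Type} [∀ i, Field (E i)] [∀ i, NumberField (E i)]

/-- The form `ψ_E` on `V_E = ⊕ E_i`, the orthogonal sum of the forms `ψ_i` given by `ξ_i`. -/
def psiE [∀ i, IsCMField (E i)] (ξ : ∀ i, E i) : LinearMap.BilinForm ℚ (∀ i, E i) :=
  ∑ i, (cmForm (ξ i)).comp (LinearMap.proj i) (LinearMap.proj i)

theorem psiE_apply [∀ i, IsCMField (E i)] (ξ : ∀ i, E i) (x y : ∀ i, E i) :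
    psiE ξ x y = ∑ i, Algebra.trace ℚ (E i) (ξ i * x i * cmConj (E i) (y i)) := by
  rw [psiE, LinearMap.BilinForm.sum_apply]
  rfl

/-- The element of `R ⊗ ∏ E_i` with given components in the `R ⊗ E_i`. -/
def tuple {R : Type u} [CommRing R] [Algebra ℚ R] (E : Fin r → Type) [∀ i, Field (E i)]
    [∀ i, NumberField (E i)] : (∀ i, R ⊗[ℚ] E i) →* R ⊗[ℚ] (∀ i, E i) :=
  ((Algebra.TensorProduct.piRight ℚ ℚ R E).symm : (∀ i, R ⊗[ℚ] E i) →* R ⊗[ℚ] (∀ i, E i))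

theorem tuple_map {R S : Type u} [CommRing R] [Algebra ℚ R] [CommRing S] [Algebra ℚ S]
    (h : R →ₐ[ℚ] S) (x : ∀ i, R ⊗[ℚ] E i) :
    tuple E (fun i => Algebra.TensorProduct.map h (AlgHom.id ℚ (E i)) (x i)) =
      Algebra.TensorProduct.map h (AlgHom.id ℚ (∀ i, E i)) (tuple E x) := by
  apply (Algebra.TensorProduct.piRight ℚ ℚ S E).injective
  have key : ∀ z : R ⊗[ℚ] (∀ i, E i), (Algebra.TensorProduct.piRight ℚ ℚ S E)
      (Algebra.TensorProduct.map h (AlgHom.id ℚ (∀ i, E i)) z) =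
      fun i => Algebra.TensorProduct.map h (AlgHom.id ℚ (E i))
        (Algebra.TensorProduct.piRight ℚ ℚ R E z i) := by
    intro z
    induction z with
    | zero => funext i; simp
    | add z w hz hw => rw [map_add, map_add, map_add, hz, hw]; funext i; simp
    | tmul s v => funext i; simp
  rw [key]
  simp [tuple]

/-- The homomorphism `∏ T^{E_i} → GL(V_E)` that lets `T^{E_i}` act on `E_i` by multiplication. -/
def torusToGL (E : Fin r → Type) [∀ i, Field (E i)] [∀ i, NumberField (E i)] :
    QGroup.pi (fun i => torus.{u} (E i)) ⟶ linGroup.{u} (∀ i, E i) :=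
  QGroup.mkHom
    (fun R => ((Units.map (((Algebra.lmul R (R ⊗[ℚ] (∀ i, E i)) :
        R ⊗[ℚ] (∀ i, E i) →* Module.End R (R ⊗[ℚ] (∀ i, E i)))).comp (tuple E))).comp
      (MulEquiv.piUnits.symm.toMonoidHom) :
      (∀ i, (R ⊗[ℚ] E i)ˣ) →* (Module.End R (R ⊗[ℚ] (∀ i, E i)))ˣ))
    (fun {R S} h (x : ∀ i, (R ⊗[ℚ] E i)ˣ) => by
      refine Units.ext (end_ext fun v => ?_)
      have h1 : (1 : S) ⊗ₜ[ℚ] v = h.hom.toLinearMap.rTensor _ (1 ⊗ₜ v) := by simp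
      change tuple E (fun i => Algebra.TensorProduct.map h.hom (AlgHom.id ℚ (E i)) (x i).1) *
        (1 ⊗ₜ[ℚ] v) = endMap h.hom (Algebra.lmul R _ (tuple E fun i => (x i).1)) (1 ⊗ₜ[ℚ] v)
      rw [h1, endMap_rTensor, tuple_map]
      exact (map_mul (Algebra.TensorProduct.map h.hom (AlgHom.id ℚ (∀ i, E i)))
        (tuple E fun i => (x i).1) (1 ⊗ₜ v)).symm)

theorem psiE_mul [∀ i, IsCMField (E i)] (ξ : ∀ i, E i) {R : Type u} [CommRing R] [Algebra ℚ R]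
    (x : ∀ i, (R ⊗[ℚ] E i)ˣ) (ν : Rˣ) (hx : ∀ i, IsMultiplier (x i) ν)
    (v w : R ⊗[ℚ] (∀ i, E i)) :
    (psiE ξ).baseChange R (tuple E (fun i => (x i).1) * v) (tuple E (fun i => (x i).1) * w) =
      ν * (psiE ξ).baseChange R v w := by
  let c : (∀ i, E i) →ₐ[ℚ] (∀ i, E i) :=
    AlgHom.pi fun i => (cmConj (E i)).comp (Pi.evalAlgHom ℚ E i)
  let t : (∀ i, E i) →ₗ[ℚ] ℚ :=
    ∑ i, Algebra.trace ℚ (E i) ∘ₗ LinearMap.mulLeft ℚ (ξ i) ∘ₗ LinearMap.proj i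
  let tR : R ⊗[ℚ] (∀ i, E i) →ₗ[R] R :=
    LinearMap.liftBaseChange R (Algebra.linearMap ℚ R ∘ₗ t)
  let cR := Algebra.TensorProduct.map (AlgHom.id ℚ R) c
  have ht : ∀ x y : ∀ i, E i, psiE ξ x y = t (x * c y) := fun x y => by
    rw [psiE_apply]
    simp [t, c, mul_assoc]
  have hB : ∀ v w, (psiE ξ).baseChange R v w = tR (v * cR w) := by
    intro v w
    induction v with
    | zero => simp
    | add v v' hv hv' => simp only [map_add, LinearMap.add_apply, hv, hv', add_mul]
    | tmul s v =>
      induction w with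
      | zero => simp
      | add w w' hw hw' => simp only [map_add, hw, hw', mul_add]
      | tmul t' w =>
        simp [LinearMap.BilinForm.baseChange_tmul, tR, cR, ht, Algebra.smul_def, mul_comm]
  have hx' : tuple E (fun i => (x i).1) * cR (tuple E (fun i => (x i).1)) =
      (ν : R) ⊗ₜ[ℚ] (1 : ∀ i, E i) := by
    apply (Algebra.TensorProduct.piRight ℚ ℚ R E).injective
    have key : ∀ z : R ⊗[ℚ] (∀ i, E i), (Algebra.TensorProduct.piRight ℚ ℚ R E) (cR z) =
        fun i => Algebra.TensorProduct.map (AlgHom.id ℚ R) (cmConj (E i))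
          (Algebra.TensorProduct.piRight ℚ ℚ R E z i) := by
      intro z
      induction z with
      | zero => funext i; simp
      | add z w hz hw => rw [map_add, map_add, map_add, hz, hw]; funext i; simp
      | tmul s v => funext i; simp [cR, c]
    rw [map_mul, key]
    funext i
    have := congrArg Units.val (hx i)
    simp [tuple]
    exact this
  have hν : ∀ z : R ⊗[ℚ] (∀ i, E i), ((ν : R) ⊗ₜ[ℚ] (1 : ∀ i, E i)) * z = (ν : R) • z := by
    intro z
    induction z with
    | zero => simp
    | add z w hz hw => rw [mul_add, hz, hw, smul_add]
    | tmul s v => simp [TensorProduct.smul_tmul']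
  have h4 : ∀ a b d e : R ⊗[ℚ] (∀ i, E i), a * b * (d * e) = a * d * (b * e) :=
    fun a b d e => mul_mul_mul_comm a b d e
  rw [hB, hB, map_mul cR, h4, hx', hν, map_smul, smul_eq_mul]

/-- The inclusion `(x_i) ↦ (v_i ↦ x_i v_i)` of the tuples with a common multiplier into
`GSp(V_E, ψ_E)`. -/
def calTToGSp [∀ i, IsCMField (E i)] (ξ : ∀ i, E i) : (calTEq.{u} E).toQGroup ⟶ (GSp.{u} (psiE ξ)).toQGroup :=
  (GSp (psiE ξ)).lift ((calTEq E).ι ≫ QGroup.piMap (fun i => (calT (E i)).ι) ≫ torusToGL E)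
    (fun R x => by
      obtain ⟨ν, hν⟩ := x.2
      exact ⟨ν, fun v w => psiE_mul ξ _ ν hν v w⟩)

end Symplectic
/-! ### The map `φ : T^K → GSp` -/

section Phi

theorem exists_reflexEmb {E F : Type} [Field E] [NumberField E] [Field F] [NumberField F]
    (t : E →ₐ[ℚ] Qbar) (e : F →ₐ[ℚ] Qbar) (h : e.fieldRange ≤ t.fieldRange) :
    ∃ j : F →ₐ[ℚ] E, t.comp j = e :=
  have h' : ∀ x, e x ∈ t.range := fun x => h ⟨x, rfl⟩
  ⟨((AlgEquiv.ofInjectiveField t).symm : t.range →ₐ[ℚ] E).comp (e.codRestrict t.range h'), by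
    ext x
    exact congrArg Subtype.val ((AlgEquiv.ofInjectiveField t).apply_symm_apply
      (e.codRestrict t.range h' x))⟩

/-- The embedding `F → E` that corresponds to an inclusion of the images of `F` and `E` in
`Qbar`. -/
def embOver {E F : Type} [Field E] [NumberField E] [Field F] [NumberField F]
    (t : E →ₐ[ℚ] Qbar) (e : F →ₐ[ℚ] Qbar) (h : e.fieldRange ≤ t.fieldRange) : F →ₐ[ℚ] E :=
  (exists_reflexEmb t e h).choose

theorem comp_embOver {E F : Type} [Field E] [NumberField E] [Field F] [NumberField F]
    (t : E →ₐ[ℚ] Qbar) (e : F →ₐ[ℚ] Qbar) (h : e.fieldRange ≤ t.fieldRange) :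
    t.comp (embOver t e h) = e :=
  (exists_reflexEmb t e h).choose_spec

theorem rho_apply {E : Type} [Field E] [NumberField E] [IsCMField E] (Φ : CMType E)
    (R : CommAlgCat.{u} ℚ) (s : diagPts (serreChars Φ.reflexField) R) (φ : E →ₐ[ℚ] Qbar) :
    tmap (AlgHom.id ℚ R) φ (Φ.rho.app R s : (R ⊗[ℚ] E)ˣ) =
      s.1 (Multiplicative.ofAdd
        (serreUniv (incl Φ.reflexField) Φ.mu Φ.isSerreCochar (CharLattice.single φ))) := by
  have h1 : Φ.rho ≫ torusToDiag E = serreRho (incl Φ.reflexField) Φ.mu Φ.isSerreCochar := by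
    rw [CMType.rho, Category.assoc, IsIso.inv_hom_id, Category.comp_id]
  have h2 := ConcreteCategory.congr_hom (congrArg (fun F => NatTrans.app F R) h1) s
  refine (torusToDiag_apply_single R _ φ).symm.trans ?_
  exact congrArg (fun t : diagPts (CharLattice E) R =>
    t.1 (Multiplicative.ofAdd (CharLattice.single φ))) h2

/-- The constant character `∑ [ρ]` of `T^K`, as a character of the Serre group. -/
def normChar (K : Type) [Field K] [NumberField K] : serreChars K :=
  ⟨fun _ => 1, fun σ => ⟨sub_self _, by
    have h : σ • (fun _ => 1 : CharLattice K) - (fun _ => 1 : CharLattice K) = 0 := sub_self _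
    rw [h, smul_zero, add_zero]⟩⟩

theorem exists_multiplier {K : Type} [Field K] [NumberField K] (R : CommAlgCat.{u} ℚ)
    (s : diagPts (serreChars K) R) : ∃ ν : Rˣ, s.1 (Multiplicative.ofAdd (normChar K)) =
      Units.map (Algebra.TensorProduct.includeLeft : R →ₐ[ℚ] R ⊗[ℚ] Qbar) ν := by
  obtain ⟨x, hx⟩ := exists_descent_units (IsScalarTower.toAlgHom ℚ ℚ Qbar)
    (s.1 (Multiplicative.ofAdd (normChar K))) (fun σ _ => (s.2 σ (normChar K)).symm)
  refine ⟨Units.map (Algebra.TensorProduct.rid ℚ ℚ R : R ⊗[ℚ] ℚ →* R) x, ?_⟩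
  refine hx.symm.trans (Eq.symm ?_)
  obtain ⟨y, hy⟩ : ∃ y : R, (x : R ⊗[ℚ] ℚ) = y ⊗ₜ 1 :=
    ⟨Algebra.TensorProduct.rid ℚ ℚ R x,
      (Algebra.TensorProduct.rid ℚ ℚ R).injective (by simp)⟩
  refine Units.ext ?_
  change _ = Algebra.TensorProduct.map (AlgHom.id ℚ R) (IsScalarTower.toAlgHom ℚ ℚ Qbar) x.1
  rw [hy, Algebra.TensorProduct.map_tmul, map_one]
  change Algebra.TensorProduct.rid ℚ ℚ R x.1 ⊗ₜ[ℚ] (1 : Qbar) = _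
  rw [hy]
  simp

theorem isMultiplier_rho {E K : Type} [Field E] [NumberField E] [IsCMField E] (Φ : CMType E)
    [Field K] [NumberField K] (j : Φ.reflexField →ₐ[ℚ] K) (R : CommAlgCat.{u} ℚ)
    (s : diagPts (serreChars K) R) (ν : Rˣ) (hν : s.1 (Multiplicative.ofAdd (normChar K)) =
      Units.map (Algebra.TensorProduct.includeLeft : R →ₐ[ℚ] R ⊗[ℚ] Qbar) ν) :
    IsMultiplier ((serreNorm j ≫ Φ.rho).app R s : (R ⊗[ℚ] E)ˣ) ν := by
  let φ : E →ₐ[ℚ] Qbar := IsAlgClosed.lift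
  let t : diagPts (serreChars Φ.reflexField) R := (serreNorm j).app R s
  apply tmap_id_injective φ
  have h0 : tmap (AlgHom.id ℚ R) φ
      (Units.map (Algebra.TensorProduct.includeLeft : R →ₐ[ℚ] R ⊗[ℚ] E) ν) =
      s.1 (Multiplicative.ofAdd (normChar K)) := by
    rw [hν]
    ext
    simp [tmap]
  rw [h0]
  let y : (R ⊗[ℚ] E)ˣ := Φ.rho.app R t
  change tmap (AlgHom.id ℚ R) φ (y * tmap (AlgHom.id ℚ R) (cmConj E) y) = _
  rw [map_mul]
  rw [tmap_tmap]
  change tmap (AlgHom.id ℚ R) φ y * tmap (AlgHom.id ℚ R) (φ.comp (cmConj E)) y = _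
  refine (congrArg₂ (· * ·) (rho_apply Φ R t φ) (rho_apply Φ R t _)).trans ?_
  rw [← gact_conj]
  rw [← map_mul, ← ofAdd_add, ← map_add]
  change s.1 (Multiplicative.ofAdd _) = _
  congr 2
  apply Subtype.ext
  funext ψ
  change univChar (incl Φ.reflexField) Φ.mu
    (CharLattice.single φ + CharLattice.single (gact conj φ)) (ψ.comp j) = 1
  obtain ⟨σ, hσ⟩ := exists_gact (incl Φ.reflexField) (ψ.comp j)
  rw [← hσ, univChar_gact Φ.isSerreCochar, ← CharLattice.smul_single, smul_add,
    CMType.smul_conj_comm, map_add, add_comm, Φ.mu_conj_add, CMType.sum_smul]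
  classical
  simp [CharLattice.single]

variable {K : Type} [Field K] [NumberField K] (τ : K →ₐ[ℚ] Qbar)
  (E : IntermediateField ℚ K) {r : ℕ} {Ei : Fin r → Type} [∀ i, Field (Ei i)]
  [∀ i, NumberField (Ei i)] (Φ : ∀ i, CMType (Ei i))
  (h : ∀ i, (Φ i).reflexField ≤ (τ.comp (incl E)).fieldRange)

/-- The inclusion `E_i^* → E`, where `E` is embedded into `Qbar` by `τ`. -/
def reflexEmb (i : Fin r) : (Φ i).reflexField →ₐ[ℚ] E :=
  embOver (τ.comp (incl E)) (incl (Φ i).reflexField) (fun _ ⟨x, hx⟩ => hx ▸ h i x.2)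

theorem comp_reflexEmb (i : Fin r) :
    (τ.comp (incl E)).comp (reflexEmb τ E Φ h i) = incl (Φ i).reflexField :=
  comp_embOver _ _ _

variable [∀ i, IsCMField (Ei i)]

/-- The composite `S^E → ∏ S^{E_i^*} → ∏ T^{E_i}`. -/
def serreToTori : serreGroup.{u} E ⟶ QGroup.pi fun i => torus.{u} (Ei i) :=
  QGroup.piLift (fun i => serreNorm (reflexEmb τ E Φ h i)) ≫ QGroup.piMap fun i => (Φ i).rho

/-- The composite `S^E → ∏ S^{E_i^*} → ∏ T^{E_i}`, as a homomorphism to the subtorus of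
`∏ 𝒯^{E_i}`. -/
def serreToCalT : serreGroup.{u} E ⟶ (calTEq.{u} Ei).toQGroup :=
  (calTEq Ei).lift
    (QGroup.piLift fun i => (calT (Ei i)).lift (serreNorm (reflexEmb τ E Φ h i) ≫ (Φ i).rho)
      (fun R s => by
        obtain ⟨ν, hν⟩ := exists_multiplier R s
        exact ⟨ν, isMultiplier_rho (Φ i) _ R s ν hν⟩))
    (fun R s => by
      obtain ⟨ν, hν⟩ := exists_multiplier R s
      exact ⟨ν, fun i => isMultiplier_rho (Φ i) _ R s ν hν⟩)

theorem serreToCalT_ι : serreToCalT.{u} τ E Φ h ≫ (calTEq Ei).ι ≫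
    QGroup.piMap (fun i => (calT (Ei i)).ι) = serreToTori τ E Φ h := rfl

/-- The map `φ : T^K → S^K → S^E → ∏ S^{E_i^*} → GSp(V_E, ψ_E)`. -/
def phi (ξ : ∀ i, Ei i) : torus.{u} K ⟶ (GSp.{u} (psiE ξ)).toQGroup :=
  serreProj K ≫ serreNorm (incl E) ≫ serreToCalT τ E Φ h ≫ calTToGSp ξ

end Phi
end

end CMTorus

open CMTorus

namespace CMTorus

/-! ### Determinants of commuting actions, in terms of embeddings -/

section Diagonalization

variable {K : Type} [Field K] [NumberField K]

/-! The heart of the matter is the identity `reflexNorm_eq`: the reflex norm $N_\Phi$ is the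
composite of $\pi^{E^*}:T^{E^*}\to S^{E^*}$ with $\rho_\Phi$. Together with the compatibility of
$\pi$ with norms, `torusNorm_serreProj`, it turns the route through Serre groups into the route
through norms and reflex norms.

To prove the identity, fix one embedding $\phi$ of $E$. Since $R\otimes E\to
R\otimes\overline{\mathbb Q}$ is injective, it is enough to compare images under $\phi$. On the
Serre side, the image of $a$ is $\prod_\psi\psi(a)^{\chi(\psi)}$ over the embeddings $\psi$ of
$E^*$, where $\chi$ is the character that the universal property attaches to $[\phi]$:
$\chi(\sigma\circ\mathrm{incl})$ is $1$ if $\sigma^{-1}\phi\in\Phi$ and $0$ otherwise.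

On the determinant side, $V\otimes_{E,\phi}\overline{\mathbb Q}$ is a sum of embeddings of $E^*$,
because a primitive element acts diagonalizably. Hence $\phi(\det
a)=\prod_\psi\psi(a)^{m_\phi(\psi)}$, with multiplicities that do not depend on $R$ and can be read
off from the trace over $E$ (`exists_mult_tensorDet`). The module $V$ is instead described by a
trace over $E^*$. The two kinds of multiplicities agree (`mult_eq_mult`): both count
$\phi\otimes\psi$ in $V\otimes\overline{\mathbb Q}$. The proof computes the trace over $\mathbb Q$
of a product $kl$ in two ways and applies linear independence of embeddings twice.

The same determinant formula for $V=K$ yields the norm: each embedding of $K$ above $\phi$ occurs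
exactly once (`tmap_torusNorm`). Finally, $N_\Phi$ lands in $\mathcal T^E$ because a point of the
Serre group takes a value in $R^\times$ on the Galois-invariant norm character, and this value is
the multiplier of its image under $\rho_\Phi$. -/

/-- A finite-dimensional representation of a number field over `Qbar` is a direct sum of
embeddings. -/
theorem exists_basis_of_embeddings {W : Type*} [AddCommGroup W] [Module ℚ W] [Module Qbar W]
    [IsScalarTower ℚ Qbar W] [FiniteDimensional Qbar W] (A : K →ₐ[ℚ] Module.End Qbar W) :
    ∃ (ι : Type) (b : Module.Basis ι Qbar W) (ψ : ι → (K →ₐ[ℚ] Qbar)),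
      ∀ k i, A k (b i) = ψ i k • b i := by
  classical
  -- The representation is determined by the image `f` of a primitive element. Its minimal
  -- polynomial is separable and annihilates `f`, so `f` is semisimple, hence diagonalizable over
  -- the algebraically closed field `Qbar`.
  let pb := Field.powerBasisOfFiniteOfSeparable ℚ K
  let f := A pb.gen
  let p := (minpoly ℚ pb.gen).map (algebraMap ℚ Qbar)
  have hp : Polynomial.aeval f p = 0 := by
    rw [Polynomial.aeval_map_algebraMap, Polynomial.aeval_algHom_apply, minpoly.aeval, map_zero]
  have hsep : p.Separable :=
    Polynomial.Separable.map (Algebra.IsSeparable.isSeparable ℚ pb.gen)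
  have hf : f.IsSemisimple :=
    Module.End.isSemisimple_of_squarefree_aeval_eq_zero hsep.squarefree hp
  have hint := DirectSum.isInternal_submodule_of_iSupIndep_of_iSup_eq_top
    f.eigenspaces_iSupIndep hf.iSup_eigenspace_eq_top
  let b := hint.collectedBasis fun μ => Module.finBasis Qbar (f.eigenspace μ)
  -- An index `i` of the collected basis is a pair whose first component `i.1` is the eigenvalue.
  -- That eigenvalue is a root of the minimal polynomial of the primitive element, hence defines an
  -- embedding of `K`.
  have hb : ∀ i, f.HasEigenvector i.1 (b i) := fun i =>
    ⟨hint.collectedBasis_mem _ i, b.ne_zero i⟩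
  have haeval : ∀ (q : Polynomial ℚ) i,
      A (Polynomial.aeval pb.gen q) (b i) = Polynomial.aeval i.1 q • b i := by
    intro q i
    rw [← Polynomial.aeval_algHom_apply, ← Polynomial.aeval_map_algebraMap Qbar,
      Module.End.aeval_apply_of_hasEigenvector (hb i), Polynomial.eval_map_algebraMap]
  have hroot : ∀ i : (μ : Qbar) × Fin (Module.finrank Qbar (f.eigenspace μ)),
      Polynomial.aeval i.1 (minpoly ℚ pb.gen) = 0 := by
    intro i
    have h := haeval (minpoly ℚ pb.gen) i
    rw [minpoly.aeval, map_zero, LinearMap.zero_apply] at h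
    exact (smul_eq_zero.mp h.symm).resolve_right (b.ne_zero i)
  refine ⟨_, b, fun i => pb.lift i.1 (hroot i), fun k i => ?_⟩
  obtain ⟨q, rfl⟩ := pb.exists_eq_aeval' k
  rw [haeval, pb.lift_aeval]

variable {n : Type} [Fintype n] [DecidableEq n]

/-- The columns of `P` are common eigenvectors of all `A k`. Writing the relation without $P^{-1}$
makes it linear in `k` entry by entry, so that it extends to `R ⊗ K`. -/
theorem exists_diagonalization (A : K →ₐ[ℚ] Matrix n n Qbar) :
    ∃ (P : Matrix n n Qbar) (ψ : n → (K →ₐ[ℚ] Qbar)), IsUnit P ∧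
      ∀ k, A k * P = P * Matrix.diagonal fun i => ψ i k := by
  obtain ⟨ι, b, ψ, h⟩ := exists_basis_of_embeddings (W := n → Qbar)
    (((Matrix.toLinAlgEquiv' (R := Qbar) (n := n)).toAlgHom.restrictScalars ℚ).comp A)
  let e : ι ≃ n := b.indexEquiv (Pi.basisFun Qbar n)
  let c := b.reindex e
  refine ⟨(Pi.basisFun Qbar n).toMatrix c, fun i => ψ (e.symm i), ?_, fun k => ?_⟩
  · have := (Pi.basisFun Qbar n).invertibleToMatrix c
    exact isUnit_of_invertible _
  · ext j i
    have hi := congrFun (h k (e.symm i)) j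
    rw [Matrix.mul_diagonal, Matrix.mul_apply]
    simp only [Module.Basis.toMatrix_apply, Pi.basisFun_repr, c, Module.Basis.reindex_apply]
    rw [mul_comm]
    exact hi

/-- The base change of a matrix representation `A` of `K` to `R ⊗ K`. -/
noncomputable def tensorMatrix (R : Type u) [CommRing R] [Algebra ℚ R] {B : Type} [CommRing B]
    [Algebra ℚ B] (A : K →ₐ[ℚ] Matrix n n B) (a : R ⊗[ℚ] K) : Matrix n n (R ⊗[ℚ] B) :=
  Matrix.of fun i j => (Matrix.entryLinearMap ℚ B i j ∘ₗ A.toLinearMap).lTensor R a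

theorem tensorMatrix_mapMatrix (R : Type u) [CommRing R] [Algebra ℚ R] {B C : Type} [CommRing B]
    [Algebra ℚ B] [CommRing C] [Algebra ℚ C] (A : K →ₐ[ℚ] Matrix n n B) (g : B →ₐ[ℚ] C)
    (a : R ⊗[ℚ] K) : tensorMatrix R (g.mapMatrix.comp A) a =
      (Algebra.TensorProduct.map (AlgHom.id ℚ R) g).mapMatrix (tensorMatrix R A a) := by
  ext i j
  change _ = Algebra.TensorProduct.map (AlgHom.id ℚ R) g (LinearMap.lTensor _ _ _)
  change LinearMap.lTensor _ _ _ = _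
  induction a with
  | zero => simp
  | add a b ha hb => simp only [map_add, ha, hb]
  | tmul r k => simp

/-- Each entry is additive in `a`, and for `a = r ⊗ k` it is `r` tensored with the corresponding
entry of the relation for `k`. Thus the diagonalization found over `Qbar` holds at all `R`-points
with the same `P` and `ψ`. -/
theorem tensorMatrix_mul_of_mul (R : Type u) [CommRing R] [Algebra ℚ R]
    (A : K →ₐ[ℚ] Matrix n n Qbar) (P : Matrix n n Qbar) (ψ : n → (K →ₐ[ℚ] Qbar))
    (h : ∀ k, A k * P = P * Matrix.diagonal fun i => ψ i k) (a : R ⊗[ℚ] K) :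
    tensorMatrix R A a *
        (Algebra.TensorProduct.includeRight : Qbar →ₐ[ℚ] R ⊗[ℚ] Qbar).mapMatrix P =
      (Algebra.TensorProduct.includeRight : Qbar →ₐ[ℚ] R ⊗[ℚ] Qbar).mapMatrix P *
        Matrix.diagonal fun i => Algebra.TensorProduct.map (AlgHom.id ℚ R) (ψ i) a := by
  ext i j
  rw [Matrix.mul_diagonal, Matrix.mul_apply]
  simp only [tensorMatrix, Matrix.of_apply, AlgHom.mapMatrix_apply, Matrix.map_apply,
    Algebra.TensorProduct.includeRight_apply]
  induction a with
  | zero => simp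
  | add a b ha hb => simp only [map_add, add_mul, mul_add, Finset.sum_add_distrib, ha, hb]
  | tmul r k =>
    have hk := congrFun (congrFun (h k) i) j
    rw [Matrix.mul_diagonal, Matrix.mul_apply] at hk
    simp [← TensorProduct.tmul_sum, hk]

/-- The determinant of a matrix representation of `K` over `Qbar` is a product of embeddings,
with the same multiplicities with which they occur in the trace. -/
theorem exists_mult_det_trace (A : K →ₐ[ℚ] Matrix n n Qbar) :
    ∃ m : (K →ₐ[ℚ] Qbar) → ℕ, (∀ k, (A k).trace = ∑ ψ, (m ψ : Qbar) * ψ k) ∧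
      ∀ (R : Type u) [CommRing R] [Algebra ℚ R] (a : R ⊗[ℚ] K),
        (tensorMatrix R A a).det =
          ∏ ψ, Algebra.TensorProduct.map (AlgHom.id ℚ R) ψ a ^ m ψ := by
  classical
  obtain ⟨P, ψ, hP, h⟩ := exists_diagonalization A
  -- The multiplicity of `ρ` is the number of basis eigenvectors on which `K` acts through `ρ`. The
  -- trace and the determinant of the diagonal matrix are regrouped along the fibres of `ψ`.
  refine ⟨fun ρ => (Finset.univ.filter fun i => ψ i = ρ).card, fun k => ?_, fun R _ _ a => ?_⟩
  · obtain ⟨U, rfl⟩ := hP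
    have hk : A k = U.1 * (Matrix.diagonal fun i => ψ i k) * U⁻¹.1 := by
      rw [← h, mul_assoc, Units.mul_inv, mul_one]
    rw [hk, Matrix.trace_mul_comm, ← mul_assoc, Units.inv_mul, one_mul, Matrix.trace_diagonal,
      ← Finset.sum_fiberwise Finset.univ ψ]
    refine Finset.sum_congr rfl fun ρ _ => ?_
    rw [← nsmul_eq_mul, ← Finset.sum_const]
    exact Finset.sum_congr rfl fun i hi => by rw [(Finset.mem_filter.mp hi).2]
  · have hdet := congrArg Matrix.det (tensorMatrix_mul_of_mul R A P ψ h a)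
    rw [Matrix.det_mul, Matrix.det_mul, mul_comm, Matrix.det_diagonal] at hdet
    -- `R ⊗ Qbar` may have zero divisors; the determinant of `P` can be cancelled because it is the
    -- image of a unit.
    have hu : IsUnit ((Algebra.TensorProduct.includeRight :
        Qbar →ₐ[ℚ] R ⊗[ℚ] Qbar).mapMatrix P).det :=
      (Matrix.isUnit_iff_isUnit_det _).mp (hP.map (AlgHom.mapMatrix _))
    rw [hu.mul_left_cancel hdet, ← Finset.prod_fiberwise Finset.univ ψ]
    refine Finset.prod_congr rfl fun ρ _ => ?_
    rw [← Finset.prod_const]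
    exact Finset.prod_congr rfl fun i hi => by rw [(Finset.mem_filter.mp hi).2]

end Diagonalization

/-! ### Trace multiplicities for two commuting number fields -/

section Multiplicities

variable {K L : Type} [Field K] [NumberField K] [Field L] [NumberField L]

/-- In the basis `1 ⊗ c i` of `R ⊗ V` over `R ⊗ L`, the matrix of `r ⊗ k` has the entries `r ⊗ A k i
j`. As a matrix determinant, `tensorDet` can be pushed through an embedding of `L` entry by entry.
-/
theorem tensorDet_eq_det (R : Type u) [CommRing R] [Algebra ℚ R] (V : Type v) [AddCommGroup V]
    [Module ℚ V] [Module L V] [Module K V] [SMulCommClass L K V] {n : Type} [Fintype n]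
    [DecidableEq n] (c : Module.Basis n L V) (A : K →ₐ[ℚ] Matrix n n L)
    (hA : ∀ k i j, A k i j = c.repr (k • c j) i) (a : R ⊗[ℚ] K) :
    tensorDet R L K V a = (tensorMatrix R A a).det := by
  let _ := tensorModule R L V
  let b := tensorBasis R (tensorAct_tmul R L V) c
  have hb : ∀ (s : R) (x : V) i, b.repr (s ⊗ₜ x) i = s ⊗ₜ[ℚ] c.repr x i := fun s x i => by
    simp [b, tensorBasis]
  refine (LinearMap.det_toMatrix b _).symm.trans (congrArg _ ?_)
  ext i j
  rw [LinearMap.toMatrix_apply]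
  change b.repr (tensorAct R K V a (b j)) i = LinearMap.lTensor _ _ _
  rw [tensorBasis_apply]
  induction a with
  | zero => simp
  | add a b ha hb => simp only [map_add, LinearMap.add_apply, Finsupp.add_apply, ha, hb]
  | tmul r k =>
    rw [tensorAct_tmul, hb]
    simp [hA]

/-- The determinant of the action of `K` on a finite-dimensional `L`-vector space is, after
applying an embedding of `L`, a product of embeddings of `K`, with the same multiplicities with
which they occur in the trace. -/
theorem exists_mult_tensorDet (V : Type v) [AddCommGroup V]
    [Module ℚ V] [Module L V] [Module K V] [SMulCommClass L K V] [SMulCommClass K L V]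
    [FiniteDimensional L V] (φ : L →ₐ[ℚ] Qbar) :
    ∃ m : (K →ₐ[ℚ] Qbar) → ℕ,
      (∀ k : K, φ (LinearMap.trace L V (DistribSMul.toLinearMap L V k)) =
        ∑ ψ, (m ψ : Qbar) * ψ k) ∧
      ∀ (R : Type u) [CommRing R] [Algebra ℚ R] (a : R ⊗[ℚ] K),
        Algebra.TensorProduct.map (AlgHom.id ℚ R) φ (tensorDet R L K V a) =
          ∏ ψ, Algebra.TensorProduct.map (AlgHom.id ℚ R) ψ a ^ m ψ := by
  classical
  let c := Module.finBasis L V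
  let A : K →ₐ[ℚ] Matrix _ _ L :=
    ((LinearMap.toMatrixAlgEquiv c).toRingEquiv.toRingHom.comp
      (Module.toModuleEnd L V)).toRatAlgHom
  have hA : ∀ k, A k = LinearMap.toMatrix c c (DistribSMul.toLinearMap L V k) := fun k => rfl
  -- Applying `φ` to the entries gives a representation of `K` over `Qbar`. Trace and determinant
  -- both commute with `φ`, so one `m` serves for both.
  obtain ⟨m, htr, hdet⟩ := exists_mult_det_trace.{u} (φ.mapMatrix.comp A)
  refine ⟨m, fun k => ?_, fun R _ _ a => ?_⟩
  · rw [← htr, LinearMap.trace_eq_matrix_trace L c, ← hA]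
    exact AddMonoidHom.map_trace (φ : L →+ Qbar) (A k)
  · rw [tensorDet_eq_det R V c A (fun k i j => by rw [hA, LinearMap.toMatrix_apply]; rfl),
      ← hdet, tensorMatrix_mapMatrix]
    exact AlgHom.map_det _ _

/-- The multiplicities of the embeddings in a trace are determined by the trace. -/
theorem eq_of_sum_embeddings_eq {m m' : (K →ₐ[ℚ] Qbar) → Qbar}
    (h : ∀ k, ∑ ψ, m ψ * ψ k = ∑ ψ, m' ψ * ψ k) : m = m' := by
  have hlin := Fintype.linearIndependent_iff.mp (linearIndependent_toLinearMap ℚ K Qbar)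
    (fun ψ => m ψ - m' ψ) (by
      ext k
      rw [LinearMap.sum_apply]
      simpa [sub_mul, sub_eq_zero] using h k)
  exact funext fun ψ => sub_eq_zero.mp (hlin ψ)

/-- The trace over `ℚ` of a linear map over an extension field. -/
theorem trace_restrictScalars_rat {V : Type v} [AddCommGroup V] [Module ℚ V] [Module L V]
    [FiniteDimensional L V] (f : V →ₗ[L] V) :
    LinearMap.trace ℚ V (f.restrictScalars ℚ) = Algebra.trace ℚ L (LinearMap.trace L V f) := by
  classical
  let b := Module.finBasis ℚ L
  let c := Module.finBasis L V
  -- In the product basis, the matrix over `ℚ` consists of blocks, each the multiplication matrix of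
  -- an entry of the matrix over `L`. Only the diagonal blocks contribute to the trace.
  rw [LinearMap.trace_eq_matrix_trace ℚ (b.smulTower' c), LinearMap.restrictScalars_toMatrix,
    LinearMap.trace_eq_matrix_trace L c, Matrix.trace, Matrix.trace, map_sum,
    Fintype.sum_prod_type]
  refine Finset.sum_congr rfl fun i _ => ?_
  rw [Algebra.trace_eq_matrix_trace b]
  rfl

/-- For commuting actions of `K` and `L` on `V`, the multiplicities of the embeddings of `K` in the
trace over `L` and those of the embeddings of `L` in the trace over `K` are the same. -/
theorem mult_eq_mult (V : Type v) [AddCommGroup V] [Module ℚ V] [Module L V] [Module K V]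
    [SMulCommClass L K V] [SMulCommClass K L V] [FiniteDimensional L V] [FiniteDimensional K V]
    (m : (L →ₐ[ℚ] Qbar) → (K →ₐ[ℚ] Qbar) → Qbar) (m' : (K →ₐ[ℚ] Qbar) → (L →ₐ[ℚ] Qbar) → Qbar)
    (hm : ∀ φ (k : K), φ (LinearMap.trace L V (DistribSMul.toLinearMap L V k)) =
      ∑ ψ, m φ ψ * ψ k)
    (hm' : ∀ ψ (l : L), ψ (LinearMap.trace K V (DistribSMul.toLinearMap K V l)) =
      ∑ φ, m' ψ φ * φ l) (φ : L →ₐ[ℚ] Qbar) (ψ : K →ₐ[ℚ] Qbar) : m φ ψ = m' ψ φ := by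
  -- Both sides are the trace over `ℚ` of `x ↦ l • k • x`, computed through `L` on the left and
  -- through `K` on the right.
  have key : ∀ (k : K) (l : L),
      algebraMap ℚ Qbar (Algebra.trace ℚ L (l * LinearMap.trace L V
        (DistribSMul.toLinearMap L V k))) =
      algebraMap ℚ Qbar (Algebra.trace ℚ K (k * LinearMap.trace K V
        (DistribSMul.toLinearMap K V l))) := by
    intro k l
    rw [← smul_eq_mul, ← smul_eq_mul, ← map_smul (LinearMap.trace L V),
      ← map_smul (LinearMap.trace K V), ← trace_restrictScalars_rat, ← trace_restrictScalars_rat]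
    congr 2
    ext x
    exact smul_comm l k x
  -- Expanding the field traces over embeddings turns `key` into an equality of two double sums in
  -- `φ l` and `ψ k`. For fixed `k`, independence of the `φ` gives the present equality;
  -- independence of the `ψ` then separates the individual coefficients.
  have h1 : ∀ k : K, (fun φ => ∑ ψ, m φ ψ * ψ k) = fun φ => ∑ ψ, m' ψ φ * ψ k := by
    intro k
    refine eq_of_sum_embeddings_eq fun l => ?_
    have h := key k l
    rw [trace_eq_sum_embeddings Qbar, trace_eq_sum_embeddings Qbar] at h
    simp only [map_mul, hm, hm'] at h
    calc _ = ∑ φ : L →ₐ[ℚ] Qbar, φ l * ∑ ψ, m φ ψ * ψ k :=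
          Finset.sum_congr rfl fun φ _ => mul_comm _ _
      _ = _ := h
      _ = _ := by
        simp only [Finset.mul_sum, Finset.sum_mul]
        rw [Finset.sum_comm]
        exact Finset.sum_congr rfl fun φ _ => Finset.sum_congr rfl fun ψ _ => by ring
  exact congrFun (eq_of_sum_embeddings_eq (m := m φ) (m' := fun ψ => m' ψ φ)
    fun k => congrFun (h1 k) φ) ψ

end Multiplicities

/-! ### Norms and reflex norms on the level of characters -/

section Norms

variable {K L : Type} [Field K] [NumberField K] [Field L] [NumberField L]

theorem tensorAct_eq_mul (R : Type u) [CommRing R] [Algebra ℚ R] [Module L K] (j : L →ₐ[ℚ] K)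
    (hj : ∀ (l : L) (x : K), l • x = j l * x) (a : R ⊗[ℚ] L) (x : R ⊗[ℚ] K) :
    tensorAct R L K a x = Algebra.TensorProduct.map (AlgHom.id ℚ R) j a * x := by
  induction x with
  | zero => rw [map_zero, mul_zero]
  | add x y hx hy => rw [map_add, mul_add, hx, hy]
  | tmul s x =>
    induction a with
    | zero => rw [map_zero, map_zero, zero_mul, LinearMap.zero_apply]
    | add a b ha hb => rw [map_add, map_add, add_mul, LinearMap.add_apply, ha, hb]
    | tmul r l => simp [tensorAct_tmul, hj]

/-- The norm of `R ⊗ K` over `R ⊗ L` is the determinant of the action of `K` on itself. -/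
theorem tensorNorm_eq_tensorDet (R : Type u) [CommRing R] [Algebra ℚ R] [Module L K]
    [SMulCommClass L K K] [FiniteDimensional L K] (j : L →ₐ[ℚ] K)
    (hj : ∀ (l : L) (x : K), l • x = j l * x) (a : R ⊗[ℚ] K) :
    tensorNorm R j a = tensorDet R L K K a := by
  let c := Module.finBasis L K
  let i1 : Module (R ⊗[ℚ] L) (R ⊗[ℚ] K) := (tensorAlgebra R j).toModule
  have hR : ∀ (r s : R) (l : L) (x : K),
      (r ⊗ₜ[ℚ] l) • (s ⊗ₜ[ℚ] x) = (r * s) ⊗ₜ[ℚ] (l • x) := fun r s l x => by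
    rw [hj]
    exact Algebra.TensorProduct.tmul_mul_tmul _ _ _ _
  let b1 := tensorBasis R hR c
  have hb1 : ∀ i, b1 i = 1 ⊗ₜ c i := tensorBasis_apply R hR c
  let i2 := tensorModule R L K
  let b2 := tensorBasis R (tensorAct_tmul R L K) c
  have hb2 : ∀ i, b2 i = 1 ⊗ₜ c i := tensorBasis_apply R (tensorAct_tmul R L K) c
  -- The norm uses the module structure `i1` coming from the algebra map, the determinant uses `i2`
  -- coming from the action. They agree by `tensorAct_eq_mul`, so the identity map is linear from
  -- one to the other. It matches the bases `b1` and `b2`, which allows `det_semilinear` to compare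
  -- the determinants.
  let H := @LinearMap.mk (R ⊗[ℚ] L) (R ⊗[ℚ] L) _ _ (RingHom.id _) (R ⊗[ℚ] K) (R ⊗[ℚ] K) _ _
    i1 i2 ⟨id, fun _ _ => rfl⟩ (fun r x => (tensorAct_eq_mul R j hj r x).symm)
  refine (@det_semilinear _ _ _ _ _ _ _ _ i1 _ i2 _ _ (RingHom.id _) H b1 b2
    (fun i => (hb1 i).trans (hb2 i).symm)
    (@Algebra.lmul _ _ _ _ (tensorAlgebra R j) a) _ (fun x => ?_)).symm
  refine (tensorAct_eq_mul R (AlgHom.id ℚ K) (fun _ _ => rfl) a x).trans ?_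
  rw [Algebra.TensorProduct.map_id]
  rfl

/-- This is the determinant formula for `K` acting on itself over `L`. The trace is then that of
`K/L`, whose image under `φ` is the sum of the embeddings of `K` that extend `φ`; so these have
multiplicity one and all others zero. -/
theorem tmap_torusNorm (R : CommAlgCat.{u} ℚ) (j : L →ₐ[ℚ] K) (φ : L →ₐ[ℚ] Qbar)
    (a : (R ⊗[ℚ] K)ˣ) [DecidablePred fun ψ : K →ₐ[ℚ] Qbar => ψ.comp j = φ] :
    tmap (AlgHom.id ℚ R) φ ((torusNorm j).app R a : (R ⊗[ℚ] L)ˣ) =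
      ∏ ψ : K →ₐ[ℚ] Qbar with ψ.comp j = φ, tmap (AlgHom.id ℚ R) ψ a := by
  let _ := j.toRingHom.toAlgebra
  let _ := φ.toRingHom.toAlgebra
  have : IsScalarTower ℚ L K := IsScalarTower.of_algebraMap_eq fun a => (j.commutes a).symm
  have : IsScalarTower ℚ L Qbar := IsScalarTower.of_algebraMap_eq fun a => (φ.commutes a).symm
  have : FiniteDimensional L K := FiniteDimensional.right ℚ L K
  obtain ⟨m, htr, hdet⟩ := exists_mult_tensorDet.{u} (L := L) (K := K) K φ
  have hm : (fun ψ => (m ψ : Qbar)) = fun ψ => if ψ.comp j = φ then 1 else 0 := by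
    refine eq_of_sum_embeddings_eq fun k => (htr k).symm.trans ?_
    refine (trace_eq_sum_embeddings (K := L) Qbar (x := k)).trans ?_
    simp only [ite_mul, one_mul, zero_mul]
    rw [← Finset.sum_filter]
    -- With `Qbar` regarded as an `L`-algebra through `φ`, the `L`-embeddings of `K` are exactly the
    -- `ψ` with `ψ.comp j = φ`.
    refine Finset.sum_bij (fun σ _ => σ.restrictScalars ℚ) (fun σ _ => ?_)
      (fun σ _ σ' _ h => AlgHom.restrictScalars_injective ℚ h) (fun ψ hψ => ?_) (fun _ _ => rfl)
    · rw [Finset.mem_filter]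
      exact ⟨Finset.mem_univ _, AlgHom.ext fun x => σ.commutes x⟩
    · exact ⟨{ ψ with commutes' := fun x => DFunLike.congr_fun (Finset.mem_filter.mp hψ).2 x },
        Finset.mem_univ _, rfl⟩
  have hm' : ∀ ψ, m ψ = if ψ.comp j = φ then 1 else 0 := fun ψ => by
    have := congrFun hm ψ
    split_ifs at this ⊢ with h <;> exact_mod_cast this
  ext
  refine (congrArg _ (tensorNorm_eq_tensorDet R j (fun _ _ => rfl) a.1)).trans ((hdet R a.1).trans ?_)
  rw [Finset.prod_filter, Units.coe_prod]
  refine Finset.prod_congr rfl fun ψ _ => ?_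
  rw [hm']
  split_ifs
  · exact pow_one _
  · exact pow_zero _

/-- The norm `T^K → T^L` induces the map `S^K → S^L` that is dual to `f ↦ f_K`. -/
theorem torusNorm_serreProj (j : L →ₐ[ℚ] K) :
    torusNorm.{u} j ≫ serreProj L = serreProj K ≫ serreNorm j := by
  classical
  refine QGroup.hom_ext' fun R (a : (R ⊗[ℚ] K)ˣ) => ?_
  apply Subtype.ext
  refine MonoidHom.ext fun f => ?_
  change ∏ φ : L →ₐ[ℚ] Qbar, tmap (AlgHom.id ℚ R) φ ((torusNorm j).app R a : (R ⊗[ℚ] L)ˣ) ^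
      ((Multiplicative.toAdd f).1 φ) =
    ∏ ψ : K →ₐ[ℚ] Qbar, tmap (AlgHom.id ℚ R) ψ a ^ ((Multiplicative.toAdd f).1 (ψ.comp j))
  -- Group the embeddings of `K` by their restriction to `L`. The exponent is constant on each
  -- group, and the product over a group is an embedding of the norm by `tmap_torusNorm`.
  rw [← Finset.prod_fiberwise Finset.univ fun ψ : K →ₐ[ℚ] Qbar => ψ.comp j]
  refine Finset.prod_congr rfl fun φ _ => ?_
  rw [tmap_torusNorm, ← Finset.prod_zpow]
  exact Finset.prod_congr rfl fun ψ hψ => by rw [(Finset.mem_filter.mp hψ).2]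

theorem serreNorm_comp {M : Type} [Field M] [NumberField M] (j : L →ₐ[ℚ] K) (i : M →ₐ[ℚ] L) :
    serreNorm.{u} j ≫ serreNorm i = serreNorm (j.comp i) := rfl

end Norms

/-! ### The reflex norm through the Serre group -/

section Reflex

variable {E : Type} [Field E] [NumberField E] [IsCMField E] (Φ : CMType E)

/-- The right side is the value at `a` of the character that the universal property attaches to
`[φ]`. The determinant supplies exponents that are multiplicities in a trace over `E`, while `V` is
given by its trace over the reflex field; `mult_eq_mult` translates between them. -/
theorem tmap_reflexNorm (V : CMType.ReflexModule.{v} Φ) (R : CommAlgCat.{u} ℚ) (φ : E →ₐ[ℚ] Qbar)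
    (a : (R ⊗[ℚ] Φ.reflexField)ˣ) :
    tmap (AlgHom.id ℚ R) φ ((Φ.reflexNorm V).app R a : (R ⊗[ℚ] E)ˣ) =
      ∏ ψ : Φ.reflexField →ₐ[ℚ] Qbar, tmap (AlgHom.id ℚ R) ψ a ^
        univChar (incl Φ.reflexField) Φ.mu (CharLattice.single φ) ψ := by
  classical
  have : SMulCommClass Φ.reflexField E V.carrier := SMulCommClass.symm _ _ _
  have : FiniteDimensional Φ.reflexField V.carrier :=
    Module.Finite.of_restrictScalars_finite ℚ _ _
  choose m htr hdet using
    fun φ => exists_mult_tensorDet.{u} (L := E) (K := Φ.reflexField) V.carrier φ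
  -- The condition on `V` concerns only the inclusion of the reflex field into `Qbar`. Every other
  -- embedding is `σ` composed with the inclusion, and applying `σ` replaces `Φ` by `σΦ`.
  have hsum : ∀ (ψ : Φ.reflexField →ₐ[ℚ] Qbar) (e : E),
      ψ (LinearMap.trace Φ.reflexField V.carrier
        (DistribSMul.toLinearMap Φ.reflexField V.carrier e)) =
      ∑ φ : E →ₐ[ℚ] Qbar,
        ((univChar (incl Φ.reflexField) Φ.mu (CharLattice.single φ) ψ : ℤ) : Qbar) * φ e := by
    intro ψ e
    obtain ⟨σ, rfl⟩ := exists_gact (incl Φ.reflexField) ψ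
    change σ ((LinearMap.trace Φ.reflexField V.carrier
        (DistribSMul.toLinearMap Φ.reflexField V.carrier e) : Φ.reflexField) : Qbar) = _
    rw [V.trace_eq, map_sum]
    have hbij : Function.Bijective (gact (K := E) σ) :=
      Finite.injective_iff_bijective.mp (CMType.gact_injective σ)
    rw [← hbij.sum_comp, ← Finset.sum_filter_add_sum_filter_not Finset.univ (· ∈ Φ.emb)]
    -- By equivariance the coefficient of `σφ` at `σ ∘ incl` is $\mu_\Phi([\phi])$, which tests
    -- whether `φ` lies in `Φ`.
    have hmu : ∀ φ : E →ₐ[ℚ] Qbar, univChar (incl Φ.reflexField) Φ.mu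
        (CharLattice.single (gact σ φ)) (gact σ (incl Φ.reflexField)) =
        if φ ∈ Φ.emb then 1 else 0 := by
      intro φ
      rw [univChar_gact Φ.isSerreCochar, ← CharLattice.smul_single, inv_smul_smul]
      change ∑ ψ ∈ Φ.emb, (Pi.single φ 1 : (E →ₐ[ℚ] Qbar) → ℤ) ψ = _
      simp [Pi.single_apply]
    rw [Finset.sum_eq_zero (s := Finset.univ.filter (· ∉ Φ.emb)) fun φ hφ => by
      rw [hmu, if_neg (Finset.mem_filter.mp hφ).2, Int.cast_zero, zero_mul], add_zero]
    refine Finset.sum_congr (by simp) fun φ hφ => ?_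
    rw [hmu, if_pos (Finset.mem_filter.mp hφ).2, Int.cast_one, one_mul]
    rfl
  have hm : ∀ ψ, (m φ ψ : ℤ) = univChar (incl Φ.reflexField) Φ.mu (CharLattice.single φ) ψ :=
    fun ψ => by
      have := mult_eq_mult V.carrier (fun φ ψ => (m φ ψ : Qbar)) _ htr hsum φ ψ
      exact_mod_cast this
  ext
  refine (hdet φ R a.1).trans ?_
  rw [Units.coe_prod]
  refine Finset.prod_congr rfl fun ψ _ => ?_
  rw [← hm, zpow_natCast]
  rfl

/-- The reflex norm is the composite of `T^{E^*} → S^{E^*}` with `ρ_Φ`. -/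
theorem reflexNorm_eq (V : CMType.ReflexModule.{v} Φ) :
    Φ.reflexNorm V = serreProj.{u} Φ.reflexField ≫ Φ.rho := by
  refine QGroup.hom_ext' fun R a => ?_
  let φ : E →ₐ[ℚ] Qbar := IsAlgClosed.lift
  -- A single embedding suffices, since `(R ⊗ E)ˣ → (R ⊗ Qbar)ˣ` is injective.
  apply tmap_id_injective φ
  exact (tmap_reflexNorm Φ V R φ a).trans
    (rho_apply Φ R ((serreProj Φ.reflexField).app R a) φ).symm

/-- Since the reflex norm factors through the Serre group, the value of the norm character there is
a multiplier for it. -/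
theorem reflexNorm_mem_calT (V : CMType.ReflexModule.{v} Φ) (R : CommAlgCat.{u} ℚ)
    (a : (torus.{u} Φ.reflexField).obj R) : (Φ.reflexNorm V).app R a ∈ (calT E).pts R := by
  rw [reflexNorm_eq]
  obtain ⟨ν, hν⟩ := exists_multiplier R ((serreProj Φ.reflexField).app R a)
  -- `isMultiplier_rho` allows a preceding norm of Serre groups; along the identity of the reflex
  -- field that norm is trivial.
  exact ⟨ν, isMultiplier_rho Φ (AlgHom.id ℚ _) R _ ν hν⟩

end Reflex

end CMTorus

/-! ### The factorization of `phi` through reflex norms -/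

theorem mainTheorem5 {K : Type} [Field K] [NumberField K] (τ : K →ₐ[ℚ] Qbar)
    (E : IntermediateField ℚ K) (hE : IsGreatest {F : IntermediateField ℚ K | IsCMField F} E)
    {r : ℕ} (Ei : Fin r → Type) [∀ i, Field (Ei i)] [∀ i, NumberField (Ei i)]
    [∀ i, IsCMField (Ei i)] (Φ : ∀ i, CMType (Ei i)) (hprim : ∀ i, (Φ i).IsPrimitive)
    (hrefl : ∀ i, (Φ i).reflexField ≤ (τ.comp (incl E)).fieldRange)
    (hinj : ∀ R : CommAlgCat.{u} ℚ, Function.Injective ((serreToTori τ E Φ hrefl).app R))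
    (ξ : ∀ i, Ei i) (hξ : ∀ i, cmConj (Ei i) (ξ i) = -ξ i)
    (hgen : ∀ i, IntermediateField.adjoin ℚ {ξ i} = ⊤)
    (V : ∀ i, CMType.ReflexModule.{v} (Φ i)) :
    ∃ N : ∀ i, torus.{u} (Φ i).reflexField ⟶ (calT.{u} (Ei i)).toQGroup,
      (∀ i, N i ≫ (calT (Ei i)).ι = (Φ i).reflexNorm (V i)) ∧
      ∃ η : torus.{u} K ⟶ (calTEq.{u} Ei).toQGroup,
        η ≫ (calTEq Ei).ι =
          QGroup.piLift (fun i => torusNorm ((incl E).comp (reflexEmb τ E Φ hrefl i))) ≫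
            QGroup.piMap N ∧
        phi τ E Φ hrefl ξ = η ≫ calTToGSp ξ := by
  -- Taking for `η` the route through the Serre groups makes both its values in the
  -- common-multiplier torus and the formula for `phi` automatic. What remains is to identify `η`
  -- with the product of norms and reflex norms, which can be checked in each `T^{E_i}`.
  refine ⟨fun i => (calT (Ei i)).lift ((Φ i).reflexNorm (V i)) (reflexNorm_mem_calT (Φ i) (V i)),
    fun i => rfl, serreProj K ≫ serreNorm (incl E) ≫ serreToCalT τ E Φ hrefl, ?_, rfl⟩
  refine QGroup.hom_ext' fun R a => funext fun i => Subtype.ext ?_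
  have h : serreProj K ≫ serreNorm (incl E) ≫ serreNorm (reflexEmb τ E Φ hrefl i) ≫ (Φ i).rho =
      torusNorm ((incl E).comp (reflexEmb τ E Φ hrefl i)) ≫ (Φ i).reflexNorm (V i) := by
    -- Replace the reflex norm by `serreProj` followed by `rho`, move the projection in front of the
    -- norm, and split the norm of Serre groups from `K` to the reflex field at `E`.
    rw [reflexNorm_eq, ← Category.assoc (torusNorm _), torusNorm_serreProj, ← serreNorm_comp]
    simp only [Category.assoc]
  exact ConcreteCategory.congr_hom (congrArg (fun F => NatTrans.app F R) h) a
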